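/- **Multi-level Nekrasov equations for $\theta=1$.** Let $N\in\mathbb N$, $k\in\{1,\dots,N\}$, $M\in\mathbb Z_{\ge 0}$. *State space.* Let $\mathfrak X$ be the finite set of arrays $\ell=(\ell^N,\ell^{N-1},\dots,\ell^k)$, $\ell^j=(\ell^j_1,\dots,\ell^j_j)$, of the form $\ell^j_i=\lambda^j_i-i$ with integers $M\ge\lambda^j_1\ge\cdots\ge\lambda^j_j\ge 0$ for $k\le j\le N$, such that consecutive levels interlace: $\lambda^{j+1}_1\ge\lambda^j_1\ge\lambda^{j+1}_2\ge\cdots\ge\lambda^j_j\ge\lambda^{j+1}_{j+1}$ for $k\le j\le N-1$. *Measure.* For $j\in\{k,\dots,N\}$ let $w_j$ be a non-vanishing complex-valued function on $[-j,M-1]$. For $\theta>0$ put $$I(\ell^{j+1},\ell^{j})=\prod_{1\le p<q\le j+1}\frac{\Gamma(\ell^{j+1}_p-\ell^{j+1}_q+1-\theta)}{\Gamma(\ell^{j+1}_p-\ell^{j+1}_q)}\prod_{1\le p<q\le j}\frac{\Gamma(\ell^{j}_p-\ell^{j}_q+1)}{\Gamma(\ell^{j}_p-\ell^{j}_q+\theta)}\prod_{1\le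 p<q\le j+1}\frac{\Gamma(\ell^{j}_p-\ell^{j+1}_q)}{\Gamma(\ell^{j}_p-\ell^{j+1}_q+1-\theta)}\prod_{1\le p\le q\le j}\frac{\Gamma(\ell^{j+1}_p-\ell^{j}_q+\theta)}{\Gamma(\ell^{j+1}_p-\ell^{j}_q+1)}\prod_{p=1}^{j}w_j(\ell^j_p),$$ $$H^t(\ell^N)=\prod_{1\le p<q\le N}\frac{\Gamma(\ell^N_p-\ell^N_q+1)}{\Gamma(\ell^N_p-\ell^N_q+1-\theta)}\prod_{p=1}^N w_N(\ell^N_p),\qquad H^b(\ell^k)=\prod_{1\le p<q\le k}\frac{\Gamma(\ell^k_p-\ell^k_q+\theta)}{\Gamma(\ell^k_p-\ell^k_q)},$$ and from now on take $\theta=1$. Assume that $Z=\sum_{\ell\in\mathfrak X}H^t(\ell^N)H^b(\ell^k)\prod_{j=k}^{N-1}I(\ell^{j+1},\ell^j)$ is non-zero, let $\mathbb P(\ell)=Z^{-1}H^t(\ell^N)H^b(\ell^k)\prod_{j=k}^{N-1}I(\ell^{j+1},\ell^j)$, a complex measure of total mass $1$ on $\mathfrak X$, and write $\mathbb E[f]=\sum_{\ell\in\mathfrak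 X}\mathbb P(\ell)f(\ell)$. *Hypotheses.* Let $\mathcal M\subseteq\mathbb C$ be open with $[-N,M]\subseteq\mathcal M$. Let $\phi_r^j$, for $j=k,\dots,N+1$ and $r=1,2$, be analytic functions on $\mathcal M$ such that for every $j\in\{k,\dots,N\}$ (the denominators on the left being non-zero on the stated intervals) $$\frac{\phi_1^{j+1}(z)}{\phi_1^j(z)}=\frac{w_j(z-1)}{w_j(z)}\ \text{ for } z\in[1-j,M-1],\qquad \frac{\phi_2^{j}(z)}{\phi_2^{j+1}(z)}=\frac{w_j(z+N-j-1)}{w_j(z+N-j)}\ \text{ for } z\in[1-N,M-N+j-1].$$ *Conclusion.* The functions $$R_1(z)=\phi_1^{N+1}(z)\,\mathbb E\Big[\prod_{p=1}^N\frac{z-\ell^N_p-1}{z-\ell^N_p}\Big]+\phi_1^k(z)\,\mathbb E\Big[\prod_{p=1}^k\frac{z-\ell^k_p}{z-\ell^k_p-1}\Big]+\sum_{j=k+1}^N\phi_1^j(z)\,\mathbb E\Big[\sum_{p=1}^j\frac1{z-\ell^j_p-1}-\sum_{p=1}^{j-1}\frac1{z-\ell^{j-1}_p}\Big]-\mathrm{Res}_1(z),$$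 $$R_2(z)=\phi_2^{N+1}(z)\,\mathbb E\Big[\prod_{p=1}^N\frac{z-\ell^N_p}{z-\ell^N_p-1}\Big]+\phi_2^k(z)\,\mathbb E\Big[\prod_{p=1}^k\frac{z-\ell^k_p+N-k-1}{z-\ell^k_p+N-k}\Big]+\sum_{j=k+1}^N\phi_2^j(z)\,\mathbb E\Big[-\sum_{p=1}^j\frac1{z-\ell^j_p+N-j}+\sum_{p=1}^{j-1}\frac1{z-\ell^{j-1}_p+N-j}\Big]-\mathrm{Res}_2(z)$$ are analytic in $\mathcal M$; that is, each of them, which its formula defines on $\mathcal M\setminus\{-N,-N+1,\dots,M\}$, agrees there with a function analytic on all of $\mathcal M$. Here $$\mathrm{Res}_1(z)=\frac{-\phi_1^{N+1}(-N)}{z+N}\,\mathbb E\Big[\prod_{p=1}^{N-1}\frac{\ell^N_p+N+1}{\ell^N_p+N}\,\mathbf 1\{\ell^N_N=-N\}\Big]+\frac{\phi_1^k(M)}{z-M}\,\mathbb E\Big[\prod_{p=2}^{k}\frac{M-\ell^k_p}{M-\ell^k_p-1}\,\mathbf 1\{\ell^k_1=M-1\}\Big]+\sum_{j=k+1}^N\frac{\phi_1^j(M)}{z-M}\,\mathbb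 E\big[\mathbf 1\{\ell^j_1=M-1\}\big],$$ $$\mathrm{Res}_2(z)=\frac{\phi_2^{N+1}(M)}{z-M}\,\mathbb E\Big[\prod_{p=2}^{N}\frac{M-\ell^N_p}{M-\ell^N_p-1}\,\mathbf 1\{\ell^N_1=M-1\}\Big]+\frac{-\phi_2^k(-N)}{z+N}\,\mathbb E\Big[\prod_{p=1}^{k-1}\frac{\ell^k_p+k+1}{\ell^k_p+k}\,\mathbf 1\{\ell^k_k=-k\}\Big]+\sum_{j=k+1}^N\frac{-\phi_2^j(-N)}{z+N}\,\mathbb E\big[\mathbf 1\{\ell^j_j=-j\}\big].$$ -/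

import Mathlib

open Finset

namespace BetaCorners

noncomputable section

/-- Arrays `(λ^N, …, λ^k)` of integers in `{0, …, M}`, level `j` having `j` entries. -/
abbrev Arr (N k M : ℕ) : Type := (j : Set.Icc k N) → Fin (j : ℕ) → Fin (M + 1)

/-- The entry `λ^j_p`, with `k ≤ j ≤ N` and `1 ≤ p ≤ j` (the value `0` elsewhere is never used). -/
def lam {N k M : ℕ} (a : Arr N k M) (j p : ℕ) : ℤ :=
  if h : (k ≤ j ∧ j ≤ N) ∧ (1 ≤ p ∧ p ≤ j) then
    ((a ⟨j, h.1⟩ ⟨p - 1, Nat.sub_one_lt_of_le h.2.1 h.2.2⟩ : ℕ) : ℤ)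
  else 0

/-- The particle location `ℓ^j_p = λ^j_p - p θ`. -/
def loc {N k M : ℕ} (θ : ℝ) (a : Arr N k M) (j p : ℕ) : ℝ := (lam a j p : ℝ) - (p : ℝ) * θ

open Classical in
/-- The state space: every level is weakly decreasing, and consecutive levels interlace,
`λ^{j+1}_1 ≥ λ^j_1 ≥ λ^{j+1}_2 ≥ ⋯ ≥ λ^j_j ≥ λ^{j+1}_{j+1}`. (An array is identified with the
collection of its particle locations.) -/
def stateSpace (N k M : ℕ) : Finset (Arr N k M) :=
  {a | (∀ j ∈ Icc k N, ∀ p, 1 ≤ p → p + 1 ≤ j → lam a j (p + 1) ≤ lam a j p) ∧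
    (∀ j ∈ Ico k N, ∀ p ∈ Icc 1 j,
      lam a j p ≤ lam a (j + 1) p ∧ lam a (j + 1) (p + 1) ≤ lam a j p)}

/-- The top factor `H^t(ℓ^N)`, where `x p = ℓ^N_p` and `w` is the weight on level `N`. -/
def Ht (θ : ℝ) (N : ℕ) (w : ℝ → ℂ) (x : ℕ → ℝ) : ℂ :=
  ((∏ p ∈ Icc 1 N, ∏ q ∈ Ioc p N,
      Real.Gamma (x p - x q + 1) / Real.Gamma (x p - x q + 1 - θ) : ℝ) : ℂ) *
    ∏ p ∈ Icc 1 N, w (x p)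

/-- The bottom factor `H^b(ℓ^k)`, where `x p = ℓ^k_p`. -/
def Hb (θ : ℝ) (k : ℕ) (x : ℕ → ℝ) : ℂ :=
  ((∏ p ∈ Icc 1 k, ∏ q ∈ Ioc p k,
      Real.Gamma (x p - x q + θ) / Real.Gamma (x p - x q) : ℝ) : ℂ)

/-- The interaction `I(ℓ^{j+1}, ℓ^j)`, where `x p = ℓ^{j+1}_p`, `y p = ℓ^j_p` and `w` is the weight
on level `j`. -/
def interaction (θ : ℝ) (j : ℕ) (w : ℝ → ℂ) (x y : ℕ → ℝ) : ℂ :=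
  (((∏ p ∈ Icc 1 (j + 1), ∏ q ∈ Ioc p (j + 1),
        Real.Gamma (x p - x q + 1 - θ) / Real.Gamma (x p - x q)) *
      (∏ p ∈ Icc 1 j, ∏ q ∈ Ioc p j,
        Real.Gamma (y p - y q + 1) / Real.Gamma (y p - y q + θ)) *
      (∏ p ∈ Icc 1 (j + 1), ∏ q ∈ Ioc p (j + 1),
        Real.Gamma (y p - x q) / Real.Gamma (y p - x q + 1 - θ)) *
      (∏ p ∈ Icc 1 j, ∏ q ∈ Icc p j,
        Real.Gamma (x p - y q + θ) / Real.Gamma (x p - y q + 1)) : ℝ) : ℂ) *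
    ∏ p ∈ Icc 1 j, w (y p)

/-- The unnormalized weight `H^t(ℓ^N) H^b(ℓ^k) ∏_{j=k}^{N-1} I(ℓ^{j+1}, ℓ^j)` of a state;
`w j` is the weight function on level `j`. -/
def weight {N k M : ℕ} (θ : ℝ) (w : ℕ → ℝ → ℂ) (a : Arr N k M) : ℂ :=
  Ht θ N (w N) (loc θ a N) * Hb θ k (loc θ a k) *
    ∏ j ∈ Ico k N, interaction θ j (w j) (loc θ a (j + 1)) (loc θ a j)

/-- The normalization constant. -/
def Z (N k M : ℕ) (θ : ℝ) (w : ℕ → ℝ → ℂ) : ℂ :=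
  ∑ a ∈ stateSpace N k M, weight θ w a

/-- The complex measure of a single state. -/
def prob {N k M : ℕ} (θ : ℝ) (w : ℕ → ℝ → ℂ) (a : Arr N k M) : ℂ :=
  (Z N k M θ w)⁻¹ * weight θ w a

/-- Expectation with respect to the complex measure `prob` on the (finite) state space. -/
def expect {N k M : ℕ} (θ : ℝ) (w : ℕ → ℝ → ℂ) (f : Arr N k M → ℂ) : ℂ :=
  ∑ a ∈ stateSpace N k M, prob θ w a * f a

/-! The functions appearing in the equations for `θ = 1`. -/

open Classical in
/-- The boundary term `Res₁`. -/
def Res₁ (N k M : ℕ) (w : ℕ → ℝ → ℂ) (φ : ℕ → ℂ → ℂ) (z : ℂ) : ℂ :=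
  (-1) * φ (N + 1) (-(N : ℂ)) / (z + N) *
      expect 1 w (fun a : Arr N k M =>
        (∏ p ∈ Icc 1 (N - 1), ((loc 1 a N p : ℂ) + N + 1) / ((loc 1 a N p : ℂ) + N)) *
          (if loc 1 a N N = -(N : ℝ) then 1 else 0)) +
    φ k (M : ℂ) / (z - M) *
      expect 1 w (fun a : Arr N k M =>
        (∏ p ∈ Icc 2 k, ((M : ℂ) - loc 1 a k p) / ((M : ℂ) - loc 1 a k p - 1)) *
          (if loc 1 a k 1 = (M : ℝ) - 1 then 1 else 0)) +
    ∑ j ∈ Icc (k + 1) N, φ j (M : ℂ) / (z - M) *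
      expect 1 w (fun a : Arr N k M => if loc 1 a j 1 = (M : ℝ) - 1 then 1 else 0)

open Classical in
/-- The boundary term `Res₂`. -/
def Res₂ (N k M : ℕ) (w : ℕ → ℝ → ℂ) (φ : ℕ → ℂ → ℂ) (z : ℂ) : ℂ :=
  φ (N + 1) (M : ℂ) / (z - M) *
      expect 1 w (fun a : Arr N k M =>
        (∏ p ∈ Icc 2 N, ((M : ℂ) - loc 1 a N p) / ((M : ℂ) - loc 1 a N p - 1)) *
          (if loc 1 a N 1 = (M : ℝ) - 1 then 1 else 0)) +
    (-1) * φ k (-(N : ℂ)) / (z + N) *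
      expect 1 w (fun a : Arr N k M =>
        (∏ p ∈ Icc 1 (k - 1), ((loc 1 a k p : ℂ) + k + 1) / ((loc 1 a k p : ℂ) + k)) *
          (if loc 1 a k k = -(k : ℝ) then 1 else 0)) +
    ∑ j ∈ Icc (k + 1) N, (-1) * φ j (-(N : ℂ)) / (z + N) *
      expect 1 w (fun a : Arr N k M => if loc 1 a j j = -(j : ℝ) then 1 else 0)

/-- The observable `R₁`, given by its formula (meaningful where no denominator vanishes). -/
def R₁ (N k M : ℕ) (w : ℕ → ℝ → ℂ) (φ : ℕ → ℂ → ℂ) (z : ℂ) : ℂ :=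
  φ (N + 1) z *
      expect 1 w (fun a : Arr N k M =>
        ∏ p ∈ Icc 1 N, (z - loc 1 a N p - 1) / (z - loc 1 a N p)) +
    φ k z *
      expect 1 w (fun a : Arr N k M =>
        ∏ p ∈ Icc 1 k, (z - loc 1 a k p) / (z - loc 1 a k p - 1)) +
    ∑ j ∈ Icc (k + 1) N, φ j z *
      expect 1 w (fun a : Arr N k M =>
        ∑ p ∈ Icc 1 j, 1 / (z - loc 1 a j p - 1) -
          ∑ p ∈ Icc 1 (j - 1), 1 / (z - loc 1 a (j - 1) p)) -
    Res₁ N k M w φ z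

/-- The observable `R₂`, given by its formula (meaningful where no denominator vanishes). -/
def R₂ (N k M : ℕ) (w : ℕ → ℝ → ℂ) (φ : ℕ → ℂ → ℂ) (z : ℂ) : ℂ :=
  φ (N + 1) z *
      expect 1 w (fun a : Arr N k M =>
        ∏ p ∈ Icc 1 N, (z - loc 1 a N p) / (z - loc 1 a N p - 1)) +
    φ k z *
      expect 1 w (fun a : Arr N k M =>
        ∏ p ∈ Icc 1 k,
          (z - loc 1 a k p + ((N : ℂ) - k - 1)) / (z - loc 1 a k p + ((N : ℂ) - k))) +
    ∑ j ∈ Icc (k + 1) N, φ j z *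
      expect 1 w (fun a : Arr N k M =>
        -∑ p ∈ Icc 1 j, 1 / (z - loc 1 a j p + ((N : ℂ) - j)) +
          ∑ p ∈ Icc 1 (j - 1), 1 / (z - loc 1 a (j - 1) p + ((N : ℂ) - j))) -
    Res₂ N k M w φ z

end

end BetaCorners

/-! At `θ = 1` the Gamma factors collapse: by interlacing every argument that occurs is positive, so
each interaction reduces to its one-particle weights, and a state has weight (Vandermonde of level
`N`) · (Vandermonde of level `k`) · (product of all `w_j(ℓ^j_p)`) (`weight_one`).

Away from `-N, …, M` the expectations in `R₁` are analytic functions plus simple poles, so it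
suffices to compute the residue at each integer `a` in this range. By partial fractions, a
configuration contributes `φ_j(a)` times the number of level-`j` particles at `a - 1` minus the
number of level-`(j-1)` particles at `a`, for `k < j ≤ N`; the two products contribute the same kind
of count at `j = k` and `j = N + 1`, weighted by `resFactor`.

For `-N < a < M` these contributions cancel between configurations, not within one. A particle at `a
- 1` on level `i` may be unable to jump to `a` alone without breaking interlacing, but it can jump
together with the particles of the same index directly above it that are also at `a - 1`, unless the
site `a` is blocked from below. Such a string on levels `i, …, j` carries `φ_i` before the jump and
`φ_{j+1}` after it. The ratio hypotheses telescope along the string and compensate the change of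
one-particle weights, while `resFactor` is exactly the change of a Vandermonde product
(`vand_shift`). Hence jumping is a weight-preserving bijection (`string_exchange`). Summing over
strings recovers the residue (`residue_eq`): maximal strings telescope, and blocked pairs occur
equally often with both signs (`sum_cross`).

At `a = -N` and `a = M` no such exchange is available; the residues there are explicit and are what
`Res₁` removes. The second equation is the first one for the reflected array `λ^j_p ↦ M -
λ^j_{j+1-p}`, evaluated at `M - N - z` (`R₂_eq_R₁`). -/

namespace BetaCorners

noncomputable section

/-! ### Calculus of simple poles at integers -/

/-- On `𝓜 ∖ S` the function `f` is an analytic function plus the simple poles `c n / (z - n)`. -/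
def HasPolarPart (𝓜 : Set ℂ) (S : Finset ℤ) (f : ℂ → ℂ) (c : ℤ → ℂ) : Prop :=
  ∃ g : ℂ → ℂ, AnalyticOnNhd ℂ g 𝓜 ∧
    ∀ z ∈ 𝓜, (∀ n ∈ S, z ≠ (n : ℂ)) → f z = g z + ∑ n ∈ S, c n / (z - n)

namespace HasPolarPart

variable {𝓜 : Set ℂ} {S : Finset ℤ} {f f' : ℂ → ℂ} {c c' : ℤ → ℂ}

theorem congr (h : HasPolarPart 𝓜 S f c)
    (hf : ∀ z ∈ 𝓜, (∀ n ∈ S, z ≠ (n : ℂ)) → f' z = f z) (hc : ∀ n ∈ S, c' n = c n) :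
    HasPolarPart 𝓜 S f' c' := by
  obtain ⟨g, hg, h⟩ := h
  refine ⟨g, hg, fun z hz hn => ?_⟩
  rw [hf z hz hn, h z hz hn]
  congr 1
  exact sum_congr rfl fun n hn => by rw [hc n hn]

theorem of_analytic (h : AnalyticOnNhd ℂ f 𝓜) : HasPolarPart 𝓜 S f (fun _ => 0) :=
  ⟨f, h, fun z _ _ => by simp⟩

theorem add (h : HasPolarPart 𝓜 S f c) (h' : HasPolarPart 𝓜 S f' c') :
    HasPolarPart 𝓜 S (fun z => f z + f' z) (fun n => c n + c' n) := by
  obtain ⟨g, hg, h⟩ := h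
  obtain ⟨g', hg', h'⟩ := h'
  refine ⟨fun z => g z + g' z, hg.add hg', fun z hz hn => ?_⟩
  beta_reduce
  rw [h z hz hn, h' z hz hn]
  simp only [add_div, sum_add_distrib]
  ring

/-- Write `φ(z)/(z - n) = φ(n)/(z - n) + dslope φ n z`; the difference quotient is analytic on `𝓜`,
also at `n`, so only the value `φ(n)` enters the polar part. -/
theorem mul_left {φ : ℂ → ℂ} (hφ : AnalyticOnNhd ℂ φ 𝓜) (h𝓜 : IsOpen 𝓜)
    (hS : ∀ n ∈ S, (n : ℂ) ∈ 𝓜) (h : HasPolarPart 𝓜 S f c) :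
    HasPolarPart 𝓜 S (fun z => φ z * f z) (fun n => φ n * c n) := by
  obtain ⟨g, hg, h⟩ := h
  refine ⟨fun z => φ z * g z + ∑ n ∈ S, c n * dslope φ n z, ?_, fun z hz hn => ?_⟩
  · refine (hφ.mul hg).add (Finset.analyticOnNhd_fun_sum _ fun n hn => ?_)
    refine analyticOnNhd_const.mul ?_
    refine DifferentiableOn.analyticOnNhd ?_ h𝓜
    exact (Complex.differentiableOn_dslope (h𝓜.mem_nhds (hS n hn))).2 hφ.differentiableOn
  · beta_reduce
    rw [h z hz hn, mul_add, add_assoc, mul_sum, ← sum_add_distrib]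
    congr 1
    refine sum_congr rfl fun n hnS => ?_
    have h0 : z - n ≠ 0 := sub_ne_zero.2 (hn n hnS)
    rw [dslope_of_ne _ (hn n hnS), slope_def_field]
    field_simp
    ring

theorem const_mul (a : ℂ) (h𝓜 : IsOpen 𝓜) (hS : ∀ n ∈ S, (n : ℂ) ∈ 𝓜)
    (h : HasPolarPart 𝓜 S f c) :
    HasPolarPart 𝓜 S (fun z => a * f z) (fun n => a * c n) :=
  h.mul_left (φ := fun _ => a) analyticOnNhd_const h𝓜 hS

theorem sum {ι : Type*} (s : Finset ι) {f : ι → ℂ → ℂ} {c : ι → ℤ → ℂ}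
    (h : ∀ i ∈ s, HasPolarPart 𝓜 S (f i) (c i)) :
    HasPolarPart 𝓜 S (fun z => ∑ i ∈ s, f i z) (fun n => ∑ i ∈ s, c i n) := by
  classical
  induction s using Finset.induction_on with
  | empty => simpa using of_analytic (f := fun _ => (0 : ℂ)) (S := S) analyticOnNhd_const
  | insert i s hi ih =>
    simp only [sum_insert hi]
    exact (h i (mem_insert_self _ _)).add (ih fun j hj => h j (mem_insert_of_mem hj))

theorem one_div_sub {b : ℤ} (hb : b ∈ S) :
    HasPolarPart 𝓜 S (fun z => 1 / (z - b)) (fun n => if b = n then 1 else 0) := by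
  refine ⟨fun _ => 0, analyticOnNhd_const, fun z _ _ => ?_⟩
  rw [zero_add, sum_eq_single b]
  · simp
  · intro n _ hn
    simp [hn.symm]
  · exact fun h => absurd hb h

end HasPolarPart

/-! ### Partial fractions and Vandermonde products -/

/-- The residue factor `∏_{q ≠ p} (1 + u / (x_p - x_q))`. -/
def resFactor (u : ℂ) (n : ℕ) (x : ℕ → ℤ) (p : ℕ) : ℂ :=
  ∏ q ∈ (Icc 1 n).erase p, (1 + u / ((x p : ℂ) - x q))

/-- Partial fraction expansion, by induction on the set of poles. The point `z` is generalized
because the induction hypothesis is needed twice: at `z`, and at the new pole `x b`, where it gives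
the new coefficient. -/
theorem prod_one_add_div {ι : Type*} [DecidableEq ι] (u : ℂ) (s : Finset ι) (x : ι → ℂ)
    (hx : Set.InjOn x s) (z : ℂ) (hz : ∀ p ∈ s, z ≠ x p) :
    ∏ p ∈ s, (1 + u / (z - x p)) =
      1 + ∑ p ∈ s, u * (∏ q ∈ s.erase p, (1 + u / (x p - x q))) * (1 / (z - x p)) := by
  induction s using Finset.induction_on generalizing z with
  | empty => simp
  | insert b s hb ih =>
    have hxs : Set.InjOn x s := hx.mono (by simp)
    have hzb : z - x b ≠ 0 := sub_ne_zero.2 (hz b (mem_insert_self _ _))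
    have hne : ∀ p ∈ s, x b ≠ x p := fun p hp h => hb <| by
      rwa [hx (mem_coe.2 (mem_insert_self b s)) (mem_coe.2 (mem_insert_of_mem hp)) h]
    rw [prod_insert hb, sum_insert hb, erase_insert hb,
      ih hxs z fun p hp => hz p (mem_insert_of_mem hp), ih hxs (x b) hne]
    -- The product of simple fractions with poles at `x b` and `x p` is split into single poles; the
    -- last term is what the pole at `x b` absorbs.
    have key : ∀ p ∈ s, u * (∏ q ∈ (insert b s).erase p, (1 + u / (x p - x q))) *
        (1 / (z - x p)) =
        u * (∏ q ∈ s.erase p, (1 + u / (x p - x q))) * (1 / (z - x p)) +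
        u / (z - x b) * (u * (∏ q ∈ s.erase p, (1 + u / (x p - x q))) * (1 / (z - x p))) -
        u / (z - x b) * (u * (∏ q ∈ s.erase p, (1 + u / (x p - x q))) * (1 / (x b - x p))) := by
      intro p hp
      have hbp : b ≠ p := fun h => hb (h ▸ hp)
      have h1 : x p - x b ≠ 0 := sub_ne_zero.2 (hne p hp).symm
      have h2 : z - x p ≠ 0 := sub_ne_zero.2 (hz p (mem_insert_of_mem hp))
      have h3 : x b - x p ≠ 0 := sub_ne_zero.2 (hne p hp)
      rw [erase_insert_of_ne hbp, prod_insert (fun h => hb (mem_of_mem_erase h))]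
      generalize ∏ q ∈ s.erase p, (1 + u / (x p - x q)) = P
      have h4 : x b - x p = -(x p - x b) := by ring
      rw [h4]
      field_simp
      ring
    rw [sum_congr rfl key, sum_sub_distrib, sum_add_distrib, ← mul_sum, ← mul_sum]
    ring

/-- The offset `d` covers both products of the observables, with poles at `ℓ_p` (`d = 0`) and at
`ℓ_p + 1` (`d = 1`); residue factors depend only on differences and do not see it. -/
theorem hasPolarPart_prod {𝓜 : Set ℂ} {S : Finset ℤ} (h𝓜 : IsOpen 𝓜)
    (hS : ∀ n ∈ S, (n : ℂ) ∈ 𝓜) (u : ℂ) (d : ℤ) (n : ℕ) (x : ℕ → ℤ)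
    (hx : Set.InjOn x (Icc 1 n : Finset ℕ)) (hxS : ∀ p ∈ Icc 1 n, x p + d ∈ S) :
    HasPolarPart 𝓜 S (fun z => ∏ p ∈ Icc 1 n, (1 + u / (z - ((x p + d : ℤ) : ℂ))))
      (fun m => u * ∑ p ∈ Icc 1 n, resFactor u n x p * (if x p + d = m then 1 else 0)) := by
  have h1 : HasPolarPart 𝓜 S
      (fun z => 1 + ∑ p ∈ Icc 1 n, u * resFactor u n x p * (1 / (z - ((x p + d : ℤ) : ℂ)))) _ :=
    (HasPolarPart.of_analytic analyticOnNhd_const).add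
      (HasPolarPart.sum (Icc 1 n) fun p hp =>
        (HasPolarPart.one_div_sub (hxS p hp)).const_mul (u * resFactor u n x p) h𝓜 hS)
  refine h1.congr (fun z _ hn => ?_) fun m _ => ?_
  · rw [prod_one_add_div u _ (fun p => ((x p + d : ℤ) : ℂ))]
    · simp [resFactor]
    · intro p hp q hq h
      exact hx hp hq (by simpa using h)
    · exact fun p hp => hn _ (hxS p hp)
  · simp only [mul_assoc, ← mul_sum, zero_add]

/-- The product `∏_{p < q} (x_p - x_q)`. -/
def vand (n : ℕ) (x : ℕ → ℤ) : ℂ :=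
  ∏ p ∈ Icc 1 n, ∏ q ∈ Ioc p n, ((x p : ℂ) - x q)

theorem vand_congr {n : ℕ} {x y : ℕ → ℤ} (h : ∀ p ∈ Icc 1 n, x p = y p) :
    vand n x = vand n y := by
  refine prod_congr rfl fun p hp => prod_congr rfl fun q hq => ?_
  simp only [mem_Icc, mem_Ioc] at hp hq
  rw [h p (by simp; omega), h q (by simp; omega)]

/-- Only the differences involving particle `p` change, each by the factor `1 + u / (x_p - x_q)`.
Thus residues of the products are ratios of weights of neighbouring configurations. -/
theorem vand_shift {n : ℕ} {x y : ℕ → ℤ} (hx : Set.InjOn x (Icc 1 n : Finset ℕ)) {p : ℕ}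
    (hp : p ∈ Icc 1 n) (u : ℤ) (hyp : y p = x p + u) (hy : ∀ q ∈ Icc 1 n, q ≠ p → y q = x q) :
    vand n y = vand n x * resFactor u n x p := by
  set g : ℕ → ℂ := fun q => 1 + (u : ℂ) / ((x p : ℂ) - x q) with hg
  have hne : ∀ q ∈ Icc 1 n, q ≠ p → (x p : ℂ) - x q ≠ 0 := fun q hq hqp h => hqp <| by
    refine hx (mem_coe.2 hq) (mem_coe.2 hp) ?_
    rw [sub_eq_zero] at h
    exact_mod_cast h.symm
  -- Row `r` of the ordered product: for `r = p` all its factors change, for `r < p` only the one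
  -- with `q = p`, for `r > p` none.
  have h1 : ∀ r ∈ Icc 1 n, ∏ q ∈ Ioc r n, ((y r : ℂ) - y q) =
      (∏ q ∈ Ioc r n, ((x r : ℂ) - x q)) *
        (if r = p then ∏ q ∈ Ioc p n, g q else if r < p then g r else 1) := by
    intro r hr
    have h2 : ∀ q ∈ Ioc r n, ((y r : ℂ) - y q) =
        ((x r : ℂ) - x q) * (if r = p then g q else if q = p then g r else 1) := by
      intro q hq
      have hq' : q ∈ Icc 1 n := by simp at hr hq ⊢; omega
      have hrq : r ≠ q := by simp at hq; omega
      split_ifs with h h'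
      · subst h
        have := hne q hq' hrq.symm
        rw [hyp, hy q hq' hrq.symm, hg]
        push_cast
        field_simp
        ring
      · subst h'
        have := hne r hr hrq
        rw [hyp, hy r hr hrq, hg]
        push_cast
        field_simp
        ring
      · rw [hy r hr h, hy q hq' h', mul_one]
    rw [prod_congr rfl h2, prod_mul_distrib]
    congr 1
    split_ifs with h h'
    · rw [h]
    · rw [prod_ite_eq' , if_pos]
      simp at hp ⊢; omega
    · rw [prod_ite_eq', if_neg]
      simp at hp ⊢; omega
  rw [vand, prod_congr rfl h1, prod_mul_distrib, ← vand]
  congr 1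
  have hsplit : Icc 1 n = insert p (Ico 1 p ∪ Ioc p n) := by
    ext q; simp at hp ⊢; omega
  have hdis : Disjoint (Ico 1 p) (Ioc p n) := by
    rw [disjoint_left]; intro q; simp; omega
  have hpn : p ∉ Ico 1 p ∪ Ioc p n := by simp
  rw [resFactor, hsplit, erase_insert hpn, prod_insert hpn, prod_union hdis, prod_union hdis,
    if_pos rfl]
  have e1 : ∏ r ∈ Ico 1 p, (if r = p then ∏ q ∈ Ioc p n, g q else if r < p then g r else 1) =
      ∏ r ∈ Ico 1 p, g r := prod_congr rfl fun r hr => by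
    simp at hr
    rw [if_neg (by omega), if_pos hr.2]
  have e2 : ∏ r ∈ Ioc p n, (if r = p then ∏ q ∈ Ioc p n, g q else if r < p then g r else 1) =
      1 := prod_eq_one fun r hr => by
    simp at hr
    rw [if_neg (by omega), if_neg (by omega)]
  rw [e1, e2, mul_one, mul_comm]

/-! ### Integer coordinates on the state space and the weight at `θ = 1` -/

section

/-- The integer particle location `ℓ^j_p = λ^j_p - p` for `θ = 1`. -/
def ell {N k M : ℕ} (a : Arr N k M) (j p : ℕ) : ℤ := lam a j p - p

/-- The defining inequalities of the state space in terms of the particle locations. -/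
structure Interlacing (N k M : ℕ) (L : ℕ → ℕ → ℤ) : Prop where
  nonneg : ∀ j p, k ≤ j → j ≤ N → 1 ≤ p → p ≤ j → 0 ≤ L j p + p
  le_top : ∀ j p, k ≤ j → j ≤ N → 1 ≤ p → p ≤ j → L j p + p ≤ M
  strict : ∀ j p, k ≤ j → j ≤ N → 1 ≤ p → p + 1 ≤ j → L j (p + 1) < L j p
  le_succ : ∀ j p, k ≤ j → j < N → 1 ≤ p → p ≤ j → L j p ≤ L (j + 1) p
  succ_lt : ∀ j p, k ≤ j → j < N → 1 ≤ p → p ≤ j → L (j + 1) (p + 1) < L j p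

variable {N k M : ℕ}

theorem lam_nonneg (a : Arr N k M) (j p : ℕ) : 0 ≤ lam a j p := by
  unfold lam; split_ifs <;> simp

theorem lam_le (a : Arr N k M) (j p : ℕ) : lam a j p ≤ M := by
  unfold lam
  split_ifs
  · exact_mod_cast Nat.lt_succ_iff.1 (Fin.is_lt _)
  · simp

theorem loc_one (a : Arr N k M) (j p : ℕ) : loc 1 a j p = (ell a j p : ℝ) := by
  simp [loc, ell]

theorem mem_stateSpace {a : Arr N k M} :
    a ∈ stateSpace N k M ↔ Interlacing N k M (ell a) := by
  simp only [stateSpace, mem_filter, mem_univ, true_and, mem_Icc, mem_Ico]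
  constructor
  · rintro ⟨h1, h2⟩
    refine ⟨?_, ?_, ?_, ?_, ?_⟩
    · intro j p _ _ _ _
      simpa [ell] using lam_nonneg a j p
    · intro j p _ _ _ _
      simpa [ell] using lam_le a j p
    · intro j p hk hN hp hpj
      have := h1 j ⟨hk, hN⟩ p hp hpj
      simp only [ell]; push_cast; omega
    · intro j p hk hN hp hpj
      have := (h2 j ⟨hk, hN⟩ p ⟨hp, hpj⟩).1
      simp only [ell]; omega
    · intro j p hk hN hp hpj
      have := (h2 j ⟨hk, hN⟩ p ⟨hp, hpj⟩).2
      simp only [ell]; push_cast; omega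
  · rintro ⟨-, -, h1, h2, h3⟩
    refine ⟨fun j hj p hp hpj => ?_, fun j hj p hp => ⟨?_, ?_⟩⟩
    · have := h1 j p hj.1 hj.2 hp hpj
      simp only [ell] at this; push_cast at this; omega
    · have := h2 j p hj.1 hj.2 hp.1 hp.2
      simp only [ell] at this; omega
    · have := h3 j p hj.1 hj.2 hp.1 hp.2
      simp only [ell] at this; push_cast at this; omega

/-- The array with prescribed particle locations (truncated to the admissible range). -/
def ofEll (N k M : ℕ) (L : ℕ → ℕ → ℤ) : Arr N k M := fun j p =>
  ⟨min (L j (p + 1) + ((p + 1 : ℕ) : ℤ)).toNat M, by omega⟩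

theorem ell_ofEll {L : ℕ → ℕ → ℤ} (h : Interlacing N k M L) {j p : ℕ} (hk : k ≤ j) (hN : j ≤ N)
    (hp : 1 ≤ p) (hpj : p ≤ j) : ell (ofEll N k M L) j p = L j p := by
  have h1 := h.nonneg j p hk hN hp hpj
  have h2 := h.le_top j p hk hN hp hpj
  rw [ell, lam, dif_pos ⟨⟨hk, hN⟩, hp, hpj⟩]
  simp only [ofEll]
  have e : p - 1 + 1 = p := by omega
  rw [e]
  omega

theorem Interlacing.congr {L L' : ℕ → ℕ → ℤ} (h : Interlacing N k M L)
    (hL : ∀ j p, k ≤ j → j ≤ N → 1 ≤ p → p ≤ j → L' j p = L j p) : Interlacing N k M L' := by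
  refine ⟨?_, ?_, ?_, ?_, ?_⟩
  · intro j p hk hN hp hpj
    rw [hL j p hk hN hp hpj]; exact h.nonneg j p hk hN hp hpj
  · intro j p hk hN hp hpj
    rw [hL j p hk hN hp hpj]; exact h.le_top j p hk hN hp hpj
  · intro j p hk hN hp hpj
    rw [hL j p hk hN hp (by omega), hL j (p + 1) hk hN (by omega) hpj]
    exact h.strict j p hk hN hp hpj
  · intro j p hk hN hp hpj
    rw [hL j p hk hN.le hp hpj, hL (j + 1) p (by omega) hN hp (by omega)]
    exact h.le_succ j p hk hN hp hpj
  · intro j p hk hN hp hpj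
    rw [hL j p hk hN.le hp hpj, hL (j + 1) (p + 1) (by omega) hN (by omega) (by omega)]
    exact h.succ_lt j p hk hN hp hpj

theorem ofEll_mem {L : ℕ → ℕ → ℤ} (h : Interlacing N k M L) :
    ofEll N k M L ∈ stateSpace N k M :=
  mem_stateSpace.2 (h.congr fun _ _ hk hN hp hpj => ell_ofEll h hk hN hp hpj)

theorem ell_ext {a b : Arr N k M}
    (h : ∀ j p, k ≤ j → j ≤ N → 1 ≤ p → p ≤ j → ell a j p = ell b j p) : a = b := by
  funext j p
  have hj := j.2
  have := h j (p + 1) hj.1 hj.2 (by omega) p.2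
  simp only [ell, lam] at this
  rw [dif_pos ⟨hj, by omega, p.2⟩, dif_pos ⟨hj, by omega, p.2⟩] at this
  simpa [Fin.ext_iff] using this

namespace Interlacing

variable {L : ℕ → ℕ → ℤ}

theorem le_of_le (h : Interlacing N k M L) {i j p : ℕ} (hij : i ≤ j) (hk : k ≤ i) (hN : j ≤ N)
    (hp : 1 ≤ p) (hpi : p ≤ i) : L i p ≤ L j p := by
  induction j, hij using Nat.le_induction with
  | base => rfl
  | succ j hij ih =>
    exact (ih (by omega)).trans (h.le_succ j p (by omega) (by omega) hp (by omega))

theorem lt_of_lt (h : Interlacing N k M L) {j p q : ℕ} (hk : k ≤ j) (hN : j ≤ N)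
    (hp : 1 ≤ p) (hpq : p < q) (hq : q ≤ j) : L j q < L j p := by
  induction q, hpq using Nat.le_induction with
  | base => exact h.strict j p hk hN hp hq
  | succ q hpq ih =>
    exact (h.strict j q hk hN (by omega) hq).trans (ih (by omega))

theorem injOn (h : Interlacing N k M L) {j : ℕ} (hk : k ≤ j) (hN : j ≤ N) :
    Set.InjOn (L j) (Icc 1 j : Finset ℕ) := by
  intro p hp q hq hpq
  simp only [coe_Icc, Set.mem_Icc] at hp hq
  rcases lt_trichotomy p q with h' | h' | h'
  · exact absurd hpq (h.lt_of_lt hk hN hp.1 h' hq.2).ne'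
  · exact h'
  · exact absurd hpq (h.lt_of_lt hk hN hq.1 h' hp.2).ne

end Interlacing

theorem Gamma_add_one_div {x : ℝ} (hx : 0 < x) : Real.Gamma (x + 1) / Real.Gamma x = x := by
  rw [Real.Gamma_add_one hx.ne', mul_div_cancel_right₀ _ (Real.Gamma_pos_of_pos hx).ne']

theorem Ht_one {w : ℝ → ℂ} {L : ℕ → ℕ → ℤ} (h : Interlacing N k M L) (hkN : k ≤ N) :
    Ht 1 N w (fun p => (L N p : ℝ)) = vand N (L N) * ∏ p ∈ Icc 1 N, w (L N p) := by
  unfold Ht vand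
  congr 1
  push_cast
  refine prod_congr rfl fun p hp => prod_congr rfl fun q hq => ?_
  simp only [mem_Icc, mem_Ioc] at hp hq
  have h1 : (0 : ℝ) < (L N p : ℝ) - L N q :=
    sub_pos.2 (by exact_mod_cast h.lt_of_lt hkN le_rfl hp.1 hq.1 hq.2)
  have := Gamma_add_one_div h1
  rw [add_sub_cancel_right, ← Complex.ofReal_div, this]
  push_cast; rfl

theorem Hb_one {L : ℕ → ℕ → ℤ} (h : Interlacing N k M L) (hkN : k ≤ N) :
    Hb 1 k (fun p => (L k p : ℝ)) = vand k (L k) := by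
  unfold Hb vand
  push_cast
  refine prod_congr rfl fun p hp => prod_congr rfl fun q hq => ?_
  simp only [mem_Icc, mem_Ioc] at hp hq
  have h1 : (0 : ℝ) < (L k p : ℝ) - L k q :=
    sub_pos.2 (by exact_mod_cast h.lt_of_lt le_rfl hkN hp.1 hq.1 hq.2)
  have := Gamma_add_one_div h1
  rw [← Complex.ofReal_div, this]
  push_cast; rfl

/-- At `θ = 1` numerator and denominator of each quotient are the same Gamma value. Interlacing
makes its argument positive, so the value is nonzero and the quotient is `1`. -/
theorem interaction_one {w : ℝ → ℂ} {L : ℕ → ℕ → ℤ} (h : Interlacing N k M L) {j : ℕ}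
    (hk : k ≤ j) (hN : j < N) :
    interaction 1 j w (fun p => (L (j + 1) p : ℝ)) (fun p => (L j p : ℝ)) =
      ∏ p ∈ Icc 1 j, w (L j p) := by
  have hpos : ∀ {x y : ℤ}, y < x → (0 : ℝ) < (x : ℝ) - y := fun h => sub_pos.2 (by exact_mod_cast h)
  have hdiv : ∀ {x : ℝ}, 0 < x → Real.Gamma x / Real.Gamma x = 1 :=
    fun hx => div_self (Real.Gamma_pos_of_pos hx).ne'
  unfold interaction
  rw [prod_eq_one, prod_eq_one, prod_eq_one, prod_eq_one]
  · simp
  · intro p hp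
    refine prod_eq_one fun q hq => ?_
    simp only [mem_Icc] at hp hq
    refine hdiv ?_
    have h1 : L j q ≤ L (j + 1) p := by
      rcases hq.1.eq_or_lt with rfl | hlt
      · exact h.le_succ j p hk hN hp.1 hp.2
      · exact (h.lt_of_lt hk hN.le hp.1 hlt hq.2).le.trans (h.le_succ j p hk hN hp.1 hp.2)
    have : (L j q : ℝ) ≤ L (j + 1) p := by exact_mod_cast h1
    linarith
  · intro p hp
    refine prod_eq_one fun q hq => ?_
    simp only [mem_Icc, mem_Ioc] at hp hq
    rw [add_sub_cancel_right]
    refine hdiv (hpos ?_)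
    have h1 := h.succ_lt j p hk hN hp.1 (by omega)
    rcases Nat.eq_or_lt_of_le hq.1 with h2 | hlt
    · rw [← h2]; exact h1
    · exact (h.lt_of_lt (by omega) hN (by omega) hlt hq.2).trans h1
  · intro p hp
    refine prod_eq_one fun q hq => ?_
    simp only [mem_Icc, mem_Ioc] at hp hq
    have := hpos (h.lt_of_lt hk hN.le hp.1 hq.1 hq.2)
    exact hdiv (by linarith)
  · intro p hp
    refine prod_eq_one fun q hq => ?_
    simp only [mem_Icc, mem_Ioc] at hp hq
    rw [add_sub_cancel_right]
    exact hdiv (hpos (h.lt_of_lt (by omega) hN hp.1 hq.1 hq.2))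

/-- The product of all one-particle weights. -/
def weightProd (N k : ℕ) (w : ℕ → ℝ → ℂ) (L : ℕ → ℕ → ℤ) : ℂ :=
  ∏ j ∈ Icc k N, ∏ p ∈ Icc 1 j, w j (L j p)

theorem weight_one {w : ℕ → ℝ → ℂ} {a : Arr N k M} (ha : a ∈ stateSpace N k M) (hkN : k ≤ N) :
    weight 1 w a = vand N (ell a N) * vand k (ell a k) * weightProd N k w (ell a) := by
  have h := mem_stateSpace.1 ha
  have e : ∀ j, loc 1 a j = fun p => (ell a j p : ℝ) := fun j => funext (loc_one a j)
  simp only [weight, e]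
  rw [Ht_one h hkN, Hb_one h hkN, prod_congr rfl fun j hj => interaction_one h
    (mem_Ico.1 hj).1 (mem_Ico.1 hj).2, weightProd]
  have : Icc k N = insert N (Ico k N) := by ext; simp; omega
  rw [this, prod_insert (by simp)]
  ring

end

/-! ### Moving strings of particles -/

section

variable {N k M i j p : ℕ} {a : ℤ} {L L' : ℕ → ℕ → ℤ}

/-- The `p`-th particles on the levels `i, …, j` sit at `a - 1`, and can all be moved to `a`. -/
structure UpString (N k : ℕ) (a : ℤ) (i j p : ℕ) (L : ℕ → ℕ → ℤ) : Prop where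
  eq : ∀ m, i ≤ m → m ≤ j → L m p = a - 1
  top : j < N → L (j + 1) p ≠ a - 1
  bot : k < i → 1 < p → L (i - 1) (p - 1) ≠ a
  base : i = k → 1 < p → L k (p - 1) ≠ a

/-- The `p`-th particles on the levels `i, …, j` sit at `a`, and can all be moved to `a - 1`. -/
structure DownString (N k : ℕ) (a : ℤ) (i j p : ℕ) (L : ℕ → ℕ → ℤ) : Prop where
  eq : ∀ m, i ≤ m → m ≤ j → L m p = a
  top : j < N → L (j + 1) (p + 1) ≠ a - 1
  bot : k < i → p ≤ i - 1 → L (i - 1) p ≠ a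
  apex : j = N → p + 1 ≤ N → L N (p + 1) ≠ a - 1

/-- `L'` arises from `L` by moving the `p`-th particles on the levels `i, …, j`
from `b` to `c`. -/
structure StringMove (N k : ℕ) (b c : ℤ) (i j p : ℕ) (L L' : ℕ → ℕ → ℤ) : Prop where
  before : ∀ m, i ≤ m → m ≤ j → L m p = b
  after : ∀ m, i ≤ m → m ≤ j → L' m p = c
  other : ∀ m q, k ≤ m → m ≤ N → 1 ≤ q → q ≤ m → ¬(i ≤ m ∧ m ≤ j ∧ q = p) → L' m q = L m q

/-- Put the `p`-th particles on the levels `i, …, j` at `c`. -/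
def setString (i j p : ℕ) (c : ℤ) (L : ℕ → ℕ → ℤ) : ℕ → ℕ → ℤ := fun m q =>
  if i ≤ m ∧ m ≤ j ∧ q = p then c else L m q

theorem stringMove_setString {b : ℤ} (c : ℤ) (h : ∀ m, i ≤ m → m ≤ j → L m p = b) :
    StringMove N k b c i j p L (setString i j p c L) :=
  ⟨h, fun _ h1 h2 => if_pos ⟨h1, h2, rfl⟩, fun _ _ _ _ _ _ h => if_neg h⟩

namespace StringMove

variable {b c : ℤ}

theorem symm (h : StringMove N k b c i j p L L') : StringMove N k c b i j p L' L :=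
  ⟨h.after, h.before, fun m q h1 h2 h3 h4 h5 => (h.other m q h1 h2 h3 h4 h5).symm⟩

theorem cases (h : StringMove N k b c i j p L L') (m q : ℕ) (h1 : k ≤ m) (h2 : m ≤ N)
    (h3 : 1 ≤ q) (h4 : q ≤ m) :
    ((i ≤ m ∧ m ≤ j ∧ q = p) ∧ L m q = b ∧ L' m q = c) ∨
      (¬(i ≤ m ∧ m ≤ j ∧ q = p) ∧ L' m q = L m q) := by
  by_cases h5 : i ≤ m ∧ m ≤ j ∧ q = p
  · left
    obtain ⟨h6, h7, rfl⟩ := h5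
    exact ⟨⟨h6, h7, rfl⟩, h.before m h6 h7, h.after m h6 h7⟩
  · exact Or.inr ⟨h5, h.other m q h1 h2 h3 h4 h5⟩

theorem congr_right {L'' : ℕ → ℕ → ℤ} (h : StringMove N k b c i j p L L') (hki : k ≤ i)
    (hjN : j ≤ N) (hp : 1 ≤ p) (hpi : p ≤ i)
    (hL : ∀ j p, k ≤ j → j ≤ N → 1 ≤ p → p ≤ j → L'' j p = L' j p) :
    StringMove N k b c i j p L L'' :=
  ⟨h.before, fun m h1 h2 => by
      rw [hL m p (by omega) (by omega) hp (by omega), h.after m h1 h2],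
    fun m q h1 h2 h3 h4 h5 => by rw [hL m q h1 h2 h3 h4, h.other m q h1 h2 h3 h4 h5]⟩

theorem unique {L'' : ℕ → ℕ → ℤ} (h : StringMove N k b c i j p L L')
    (h' : StringMove N k b c i j p L L'') (m q : ℕ) (h1 : k ≤ m) (h2 : m ≤ N)
    (h3 : 1 ≤ q) (h4 : q ≤ m) : L' m q = L'' m q := by
  rcases h.cases m q h1 h2 h3 h4 with ⟨h5, -, h6⟩ | ⟨h5, h6⟩ <;>
  rcases h'.cases m q h1 h2 h3 h4 with ⟨h7, -, h8⟩ | ⟨h7, h8⟩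
  · rw [h6, h8]
  · exact absurd h5 h7
  · exact absurd h7 h5
  · rw [h6, h8]

end StringMove

/-- Only the neighbours of the string matter: particle `p` on level `j + 1`, particle `p - 1` on
level `i - 1`, and the left neighbours `p - 1` on the levels of the string itself. -/
theorem UpString.interlacing (hU : UpString N k a i j p L) (h : Interlacing N k M L)
    (hm : StringMove N k (a - 1) a i j p L L') (hki : k ≤ i) (hij : i ≤ j) (hjN : j ≤ N)
    (hp : 1 ≤ p) (hpi : p ≤ i) (haM : a < M) : Interlacing N k M L' := by
  have hB : k < i → 1 < p → a < L (i - 1) (p - 1) := fun h1 h2 => by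
    have h3 := h.succ_lt (i - 1) (p - 1) (by omega) (by omega) (by omega) (by omega)
    rw [Nat.sub_add_cancel (by omega), Nat.sub_add_cancel (by omega), hU.eq i le_rfl hij] at h3
    have := hU.bot h1 h2
    omega
  -- A particle of fixed index moves weakly right as the level grows, so it is enough to free the
  -- site `a` at level `i`; there this comes from `base` if `i = k`, and from level `i - 1`
  -- otherwise.
  have hA : ∀ m, i ≤ m → m ≤ j → 1 < p → a < L m (p - 1) := fun m h1 h2 h3 => by
    refine lt_of_lt_of_le ?_ (h.le_of_le h1 hki (by omega) (by omega) (by omega))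
    rcases hki.eq_or_lt with h4 | h4
    · subst h4
      have h5 := hU.base rfl h3
      have h6 := h.strict k (p - 1) le_rfl (by omega) (by omega) (by omega)
      rw [Nat.sub_add_cancel (by omega), hU.eq k le_rfl hij] at h6
      omega
    · refine (hB h4 h3).trans_le ?_
      have := h.le_succ (i - 1) (p - 1) (by omega) (by omega) (by omega) (by omega)
      rwa [Nat.sub_add_cancel (by omega)] at this
  have hC : j < N → a ≤ L (j + 1) p := fun h1 => by
    have h2 := h.le_succ j p (by omega) h1 hp (by omega)
    rw [hU.eq j hij le_rfl] at h2
    have := hU.top h1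
    omega
  refine ⟨?_, ?_, ?_, ?_, ?_⟩
  · intro m q h1 h2 h3 h4
    have := h.nonneg m q h1 h2 h3 h4
    rcases hm.cases m q h1 h2 h3 h4 with ⟨_, _, _⟩ | ⟨_, _⟩ <;> omega
  · intro m q h1 h2 h3 h4
    have h5 := h.le_top m q h1 h2 h3 h4
    rcases hm.cases m q h1 h2 h3 h4 with ⟨⟨h6, h7, rfl⟩, h8, h9⟩ | ⟨_, _⟩
    -- The wall at `M` is felt only by the first particle, through `a < M`; any other particle has
    -- its left neighbour beyond `a`.
    · rcases h3.eq_or_lt with h10 | h10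
      · omega
      · have := hA m h6 h7 h10
        have := h.le_top m (q - 1) h1 h2 (by omega) (by omega)
        omega
    · omega
  · intro m q h1 h2 h3 h4
    have h5 := h.strict m q h1 h2 h3 h4
    rcases hm.cases m q h1 h2 h3 (by omega) with ⟨⟨_, _, _⟩, _, _⟩ | ⟨_, _⟩ <;>
    rcases hm.cases m (q + 1) h1 h2 (by omega) h4 with ⟨⟨h6, h7, rfl⟩, _, _⟩ | ⟨_, _⟩
    · omega
    · omega
    · have := hA m h6 h7 (by omega)
      rw [Nat.add_sub_cancel] at this
      omega
    · omega
  · intro m q h1 h2 h3 h4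
    have h5 := h.le_succ m q h1 h2 h3 h4
    rcases hm.cases m q h1 h2.le h3 h4 with ⟨⟨h6, h7, rfl⟩, _, _⟩ | ⟨_, _⟩ <;>
    rcases hm.cases (m + 1) q (by omega) h2 h3 (by omega) with ⟨⟨_, _, _⟩, _, _⟩ | ⟨h8, _⟩
    · omega
    · obtain rfl : m = j := by omega
      have := hC h2
      omega
    · omega
    · omega
  · intro m q h1 h2 h3 h4
    have h5 := h.succ_lt m q h1 h2 h3 h4
    rcases hm.cases m q h1 h2.le h3 h4 with ⟨⟨_, _, _⟩, _, _⟩ | ⟨_, _⟩ <;>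
    rcases hm.cases (m + 1) (q + 1) (by omega) h2 (by omega) (by omega) with
      ⟨⟨h6, h7, rfl⟩, _, _⟩ | ⟨_, _⟩
    · omega
    · omega
    · rcases h6.eq_or_lt with h8 | h8
      · subst h8
        have := hB (by omega) (by omega)
        simp only [Nat.add_sub_cancel] at this
        omega
      · have := hA m (by omega) (by omega) (by omega)
        rw [Nat.add_sub_cancel] at this
        omega
    · omega

/-- Maximality and absence of obstruction exchange their ends under the jump: the conditions for
jumping back are the inequalities satisfied by `L` with the string still at `a - 1`. -/
theorem UpString.downString (hU : UpString N k a i j p L) (h : Interlacing N k M L)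
    (hm : StringMove N k (a - 1) a i j p L L') (hki : k ≤ i) (hij : i ≤ j) (hjN : j ≤ N)
    (hp : 1 ≤ p) (hpi : p ≤ i) : DownString N k a i j p L' := by
  refine ⟨hm.after, fun h1 => ?_, fun h1 h2 => ?_, fun h1 h2 => ?_⟩
  · have h3 := h.succ_lt j p (by omega) h1 hp (by omega)
    rw [hU.eq j hij le_rfl] at h3
    rw [hm.other (j + 1) (p + 1) (by omega) h1 (by omega) (by omega) (by omega)]
    exact h3.ne
  · have h3 := h.le_succ (i - 1) p (by omega) (by omega) hp h2
    rw [Nat.sub_add_cancel (by omega), hU.eq i le_rfl hij] at h3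
    rw [hm.other (i - 1) p (by omega) (by omega) hp h2 (by omega)]
    omega
  · subst h1
    have h3 := h.strict j p (by omega) le_rfl hp h2
    rw [hU.eq j hij le_rfl] at h3
    rw [hm.other j (p + 1) (by omega) le_rfl (by omega) h2 (by omega)]
    exact h3.ne

theorem DownString.interlacing (hD : DownString N k a i j p L) (h : Interlacing N k M L)
    (hm : StringMove N k a (a - 1) i j p L L') (hki : k ≤ i) (hij : i ≤ j) (hjN : j ≤ N)
    (hp : 1 ≤ p) (hpi : p ≤ i) (haN : -(N : ℤ) < a) : Interlacing N k M L' := by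
  have hB : j < N → L (j + 1) (p + 1) < a - 1 := fun h1 => by
    have h3 := h.succ_lt j p (by omega) h1 hp (by omega)
    rw [hD.eq j hij le_rfl] at h3
    have := hD.top h1
    omega
  have hA : ∀ m, i ≤ m → m ≤ j → p + 1 ≤ m → L m (p + 1) < a - 1 := fun m h1 h2 h3 => by
    refine lt_of_le_of_lt (h.le_of_le h2 (by omega) hjN (by omega) h3) ?_
    rcases hjN.eq_or_lt with h4 | h4
    · subst h4
      have h5 := hD.apex rfl (by omega)
      have h6 := h.strict j p (by omega) le_rfl hp (by omega)
      rw [hD.eq j hij le_rfl] at h6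
      omega
    · exact (h.le_succ j (p + 1) (by omega) h4 (by omega) (by omega)).trans_lt (hB h4)
  have hC : k < i → p ≤ i - 1 → L (i - 1) p ≤ a - 1 := fun h1 h2 => by
    have h3 := h.le_succ (i - 1) p (by omega) (by omega) hp h2
    rw [Nat.sub_add_cancel (by omega), hD.eq i le_rfl hij] at h3
    have := hD.bot h1 h2
    omega
  -- The lower wall is felt only by the last particle of level `N`, through `-N < a`; otherwise a
  -- particle of index `p + 1` already sits strictly below `a - 1`.
  have hlow : 0 ≤ a - 1 + p := by
    rcases hjN.eq_or_lt with h4 | h4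
    · subst h4
      rcases (hpi.trans hij).eq_or_lt with h5 | h5
      · omega
      · have := hA j hij le_rfl h5
        have := h.nonneg j (p + 1) (by omega) le_rfl (by omega) h5
        omega
    · have := hB h4
      have := h.nonneg (j + 1) (p + 1) (by omega) h4 (by omega) (by omega)
      omega
  refine ⟨?_, ?_, ?_, ?_, ?_⟩
  · intro m q h1 h2 h3 h4
    have := h.nonneg m q h1 h2 h3 h4
    rcases hm.cases m q h1 h2 h3 h4 with ⟨⟨_, _, rfl⟩, _, _⟩ | ⟨_, _⟩ <;> omega
  · intro m q h1 h2 h3 h4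
    have h5 := h.le_top m q h1 h2 h3 h4
    rcases hm.cases m q h1 h2 h3 h4 with ⟨⟨h6, h7, rfl⟩, h8, h9⟩ | ⟨_, _⟩ <;> omega
  · intro m q h1 h2 h3 h4
    have h5 := h.strict m q h1 h2 h3 h4
    rcases hm.cases m q h1 h2 h3 (by omega) with ⟨⟨h6, h7, rfl⟩, _, _⟩ | ⟨_, _⟩ <;>
    rcases hm.cases m (q + 1) h1 h2 (by omega) h4 with ⟨⟨_, _, _⟩, _, _⟩ | ⟨_, _⟩
    · omega
    · have := hA m h6 h7 h4
      omega
    · omega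
    · omega
  · intro m q h1 h2 h3 h4
    have h5 := h.le_succ m q h1 h2 h3 h4
    rcases hm.cases m q h1 h2.le h3 h4 with ⟨⟨_, _, _⟩, _, _⟩ | ⟨_, _⟩ <;>
    rcases hm.cases (m + 1) q (by omega) h2 h3 (by omega) with ⟨⟨h6, h7, rfl⟩, _, _⟩ | ⟨h8, _⟩
    · omega
    · omega
    · obtain rfl : i = m + 1 := by omega
      have := hC (by omega) (by omega)
      rw [Nat.add_sub_cancel] at this
      omega
    · omega
  · intro m q h1 h2 h3 h4
    have h5 := h.succ_lt m q h1 h2 h3 h4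
    rcases hm.cases m q h1 h2.le h3 h4 with ⟨⟨h6, h7, rfl⟩, _, _⟩ | ⟨_, _⟩ <;>
    rcases hm.cases (m + 1) (q + 1) (by omega) h2 (by omega) (by omega) with
      ⟨⟨_, _, _⟩, _, _⟩ | ⟨_, _⟩
    · omega
    · rcases h7.eq_or_lt with h8 | h8
      · subst h8
        have := hB h2
        omega
      · have := hA (m + 1) (by omega) (by omega) (by omega)
        omega
    · omega
    · omega

theorem DownString.upString (hD : DownString N k a i j p L) (h : Interlacing N k M L)
    (hm : StringMove N k a (a - 1) i j p L L') (hki : k ≤ i) (hij : i ≤ j) (hjN : j ≤ N)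
    (hp : 1 ≤ p) (hpi : p ≤ i) : UpString N k a i j p L' := by
  refine ⟨hm.after, fun h1 => ?_, fun h1 h2 => ?_, fun h1 h2 => ?_⟩
  · have h3 := h.le_succ j p (by omega) h1 hp (by omega)
    rw [hD.eq j hij le_rfl] at h3
    rw [hm.other (j + 1) p (by omega) h1 (by omega) (by omega) (by omega)]
    omega
  · have h3 := h.succ_lt (i - 1) (p - 1) (by omega) (by omega) (by omega) (by omega)
    rw [Nat.sub_add_cancel (by omega), Nat.sub_add_cancel (by omega), hD.eq i le_rfl hij] at h3
    rw [hm.other (i - 1) (p - 1) (by omega) (by omega) (by omega) (by omega) (by omega)]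
    exact h3.ne'
  · subst h1
    have h3 := h.strict i (p - 1) le_rfl (by omega) (by omega) (by omega)
    rw [Nat.sub_add_cancel (by omega), hD.eq i le_rfl hij] at h3
    rw [hm.other i (p - 1) le_rfl (by omega) (by omega) (by omega) (by omega)]
    exact h3.ne'

theorem StringMove.weightProd_mul (hm : StringMove N k (a - 1) a i j p L L') (hki : k ≤ i)
    (hjN : j ≤ N) (hp : 1 ≤ p) (hpi : p ≤ i) (w : ℕ → ℝ → ℂ) :
    weightProd N k w L' * ∏ m ∈ Icc i j, w m ((a : ℝ) - 1) =
      weightProd N k w L * ∏ m ∈ Icc i j, w m (a : ℝ) := by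
  have hsub : Icc i j ⊆ Icc k N := Icc_subset_Icc hki hjN
  have e : ∀ f : ℕ → ℂ, ∏ m ∈ Icc i j, f m = ∏ m ∈ Icc k N, if m ∈ Icc i j then f m else 1 :=
    fun f => by rw [prod_ite_mem, inter_eq_right.2 hsub]
  rw [e, e, weightProd, weightProd, ← prod_mul_distrib, ← prod_mul_distrib]
  refine prod_congr rfl fun m hmk => ?_
  rw [mem_Icc] at hmk
  by_cases h : m ∈ Icc i j
  · rw [if_pos h, if_pos h]
    rw [mem_Icc] at h
    have hpm : p ∈ Icc 1 m := by rw [mem_Icc]; omega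
    rw [← mul_prod_erase _ _ hpm, ← mul_prod_erase _ _ hpm, hm.before m h.1 h.2,
      hm.after m h.1 h.2]
    rw [prod_congr rfl fun q hq => ?_]
    · push_cast; ring
    · rw [mem_erase, mem_Icc] at hq
      rw [hm.other m q hmk.1 hmk.2 hq.2.1 hq.2.2 (by tauto)]
  · rw [if_neg h, if_neg h, mul_one, mul_one]
    refine prod_congr rfl fun q hq => ?_
    rw [mem_Icc] at hq h
    rw [hm.other m q hmk.1 hmk.2 hq.1 hq.2 (by tauto)]

/-- The ratio hypotheses telescope along the levels of the string, which is why a string starting at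
`i` pairs `Φ i` with `Φ (j + 1)`. -/
theorem mul_prod_ratio {w : ℕ → ℝ → ℂ} {Φ : ℕ → ℂ} (hij : i ≤ j)
    (hΦ : ∀ m, i ≤ m → m ≤ j → Φ (m + 1) * w m (a : ℝ) = Φ m * w m ((a : ℝ) - 1)) :
    Φ (j + 1) * ∏ m ∈ Icc i j, w m (a : ℝ) = Φ i * ∏ m ∈ Icc i j, w m ((a : ℝ) - 1) := by
  induction j, hij using Nat.le_induction with
  | base => simpa using hΦ i le_rfl le_rfl
  | succ j hij ih =>
    rw [← insert_Icc_right_eq_Icc_add_one (by omega), prod_insert (by simp), prod_insert (by simp)]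
    have h1 := hΦ (j + 1) (by omega) le_rfl
    have h2 := ih fun m h1 h2 => hΦ m h1 (by omega)
    linear_combination (∏ m ∈ Icc i j, w m (a : ℝ)) * h1 + w (j + 1) ((a : ℝ) - 1) * h2

/-- The weight of a state in terms of its particle locations. -/
def weightEll (N k : ℕ) (w : ℕ → ℝ → ℂ) (L : ℕ → ℕ → ℤ) : ℂ :=
  vand N (L N) * vand k (L k) * weightProd N k w L

theorem StringMove.vand_bot (hm : StringMove N k (a - 1) a i j p L L') (h : Interlacing N k M L)
    (hki : k ≤ i) (hij : i ≤ j) (hjN : j ≤ N) (hp : 1 ≤ p) (hpi : p ≤ i) :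
    vand k (L' k) = vand k (L k) * if i = k then resFactor 1 k (L k) p else 1 := by
  split_ifs with hik
  · subst hik
    have := vand_shift (y := L' i) (h.injOn le_rfl (by omega)) (mem_Icc.2 ⟨hp, hpi⟩) 1
      (by rw [hm.before i le_rfl hij, hm.after i le_rfl hij]; ring)
      fun q hq hqp => hm.other i q le_rfl (by omega) (mem_Icc.1 hq).1 (mem_Icc.1 hq).2 (by omega)
    simpa using this
  · rw [mul_one]
    exact vand_congr fun q hq =>
      hm.other k q le_rfl (by omega) (mem_Icc.1 hq).1 (mem_Icc.1 hq).2 (by omega)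

theorem StringMove.vand_top (hm : StringMove N k (a - 1) a i j p L L')
    (h : Interlacing N k M L') (hki : k ≤ i) (hij : i ≤ j) (hjN : j ≤ N) (hp : 1 ≤ p)
    (hpi : p ≤ i) :
    vand N (L N) = vand N (L' N) * if j = N then resFactor (-1) N (L' N) p else 1 := by
  split_ifs with hjN'
  · subst hjN'
    have := vand_shift (y := L j) (h.injOn (by omega) le_rfl) (mem_Icc.2 ⟨hp, by omega⟩) (-1)
      (by rw [hm.before j hij le_rfl, hm.after j hij le_rfl]; ring)
      fun q hq hqp => (hm.other j q (by omega) le_rfl (mem_Icc.1 hq).1 (mem_Icc.1 hq).2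
        (by omega)).symm
    simpa using this
  · rw [mul_one]
    exact vand_congr fun q hq =>
      (hm.other N q (by omega) le_rfl (mem_Icc.1 hq).1 (mem_Icc.1 hq).2 (by omega)).symm

/-- With its residue factor, either side has the same Vandermonde part: level `N` before the jump
times level `k` after it. What remains is the ratio of one-particle weights, compensated by `Φ (j +
1)` against `Φ i`. Nonvanishing of `w m (a - 1)` allows the common factor to be cancelled. -/
theorem StringMove.weight_eq (hm : StringMove N k (a - 1) a i j p L L')
    (h : Interlacing N k M L) (h' : Interlacing N k M L') (hki : k ≤ i) (hij : i ≤ j)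
    (hjN : j ≤ N) (hp : 1 ≤ p) (hpi : p ≤ i) {w : ℕ → ℝ → ℂ} {Φ : ℕ → ℂ}
    (hw : ∀ m, i ≤ m → m ≤ j → w m ((a : ℝ) - 1) ≠ 0)
    (hΦ : ∀ m, i ≤ m → m ≤ j → Φ (m + 1) * w m (a : ℝ) = Φ m * w m ((a : ℝ) - 1)) :
    Φ i * (weightEll N k w L * if i = k then resFactor 1 k (L k) p else 1) =
      Φ (j + 1) * (weightEll N k w L' * if j = N then resFactor (-1) N (L' N) p else 1) := by
  have h1 := hm.vand_bot h hki hij hjN hp hpi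
  have h2 := hm.vand_top h' hki hij hjN hp hpi
  have h3 := hm.weightProd_mul hki hjN hp hpi w
  have h4 := mul_prod_ratio hij hΦ
  have h5 : ∏ m ∈ Icc i j, w m ((a : ℝ) - 1) ≠ 0 :=
    prod_ne_zero_iff.2 fun m hm => hw m (mem_Icc.1 hm).1 (mem_Icc.1 hm).2
  have e1 : weightEll N k w L * (if i = k then resFactor 1 k (L k) p else 1) =
      vand N (L N) * vand k (L' k) * weightProd N k w L := by rw [weightEll, h1]; ring
  have e2 : weightEll N k w L' * (if j = N then resFactor (-1) N (L' N) p else 1) =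
      vand N (L N) * vand k (L' k) * weightProd N k w L' := by rw [weightEll, h2]; ring
  rw [e1, e2]
  apply mul_right_cancel₀ h5
  linear_combination (-vand N (L N) * vand k (L' k)) * (weightProd N k w L * h4 + Φ (j + 1) * h3)

end

/-! ### Cancellation of the interior residues -/

section

variable {N k M i j p : ℕ} {a : ℤ} {L L' : ℕ → ℕ → ℤ}

/-- The indicator that the `p`-th particle on level `m` exists and sits at `c`. -/
def occ (N k : ℕ) (L : ℕ → ℕ → ℤ) (c : ℤ) (m p : ℕ) : ℂ :=
  if (k ≤ m ∧ m ≤ N) ∧ (1 ≤ p ∧ p ≤ m) ∧ L m p = c then 1 else 0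

theorem occ_eq_one {c : ℤ} {m p : ℕ} (h1 : k ≤ m) (h2 : m ≤ N) (h3 : 1 ≤ p) (h4 : p ≤ m)
    (h5 : L m p = c) : occ N k L c m p = 1 := if_pos ⟨⟨h1, h2⟩, ⟨h3, h4⟩, h5⟩

theorem occ_eq_zero {c : ℤ} {m p : ℕ}
    (h : k ≤ m → m ≤ N → 1 ≤ p → p ≤ m → L m p ≠ c) : occ N k L c m p = 0 :=
  if_neg fun ⟨⟨h1, h2⟩, ⟨h3, h4⟩, h5⟩ => h h1 h2 h3 h4 h5

theorem sum_occ_mul {c : ℤ} {m : ℕ} (h1 : k ≤ m) (h2 : m ≤ N) (f : ℕ → ℂ) :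
    ∑ p ∈ Icc 1 N, occ N k L c m p * f p =
      ∑ p ∈ Icc 1 m, f p * (if L m p = c then 1 else 0) := by
  symm
  apply sum_subset_zero_on_sdiff (Icc_subset_Icc le_rfl h2)
  · intro p hp
    rw [mem_sdiff, mem_Icc, mem_Icc] at hp
    rw [occ_eq_zero fun _ _ h3 h4 => absurd ⟨h3, h4⟩ hp.2, zero_mul]
  · intro p hp
    rw [mem_Icc] at hp
    rw [mul_comm, occ]
    simp [h1, h2, hp.1, hp.2]

theorem sum_occ {c : ℤ} {m : ℕ} (h1 : k ≤ m) (h2 : m ≤ N) :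
    ∑ p ∈ Icc 1 N, occ N k L c m p = ∑ p ∈ Icc 1 m, (if L m p = c then 1 else 0) := by
  simpa using sum_occ_mul (L := L) (c := c) h1 h2 fun _ => 1

/-- The weight with which a string on the levels `i, …, j` is counted before moving up. -/
def upTerm (N k : ℕ) (a : ℤ) (L : ℕ → ℕ → ℤ) (i j p : ℕ) : ℂ :=
  (∏ m ∈ Icc i j, occ N k L (a - 1) m p) * (1 - occ N k L (a - 1) (j + 1) p) *
    ((1 - occ N k L a (i - 1) (p - 1)) * if i = k then resFactor 1 k (L k) p else 1)

/-- The weight with which a string on the levels `i, …, j` is counted before moving down. -/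
def downTerm (N k : ℕ) (a : ℤ) (L : ℕ → ℕ → ℤ) (i j p : ℕ) : ℂ :=
  (∏ m ∈ Icc i j, occ N k L a m p) * (1 - occ N k L a (i - 1) p) *
    ((1 - occ N k L (a - 1) (j + 1) (p + 1)) * if j = N then resFactor (-1) N (L N) p else 1)

/-- If the target site is occupied, one factor is `1 + u / (-u) = 0`. Hence on levels `k` and `N`
the residue factor itself excludes blocked moves. -/
theorem resFactor_eq_zero {u : ℤ} {n p q : ℕ} {x : ℕ → ℤ} (hu : u ≠ 0) (hq : q ∈ Icc 1 n)
    (hqp : q ≠ p) (h : x q = x p + u) : resFactor u n x p = 0 := by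
  refine prod_eq_zero (mem_erase.2 ⟨hqp, hq⟩) ?_
  have : (u : ℂ) ≠ 0 := by exact_mod_cast hu
  have e : (x p : ℂ) - x q = -u := by rw [h]; push_cast; ring
  rw [e, div_neg, div_self this, add_neg_cancel]

-- The indicators encode `eq`, `top` and `bot` of an up-string; the remaining condition `base` need
-- not be imposed, since `resFactor` vanishes when it fails.
open Classical in
theorem upTerm_eq (hk : 1 ≤ k) (hki : k ≤ i) (hij : i ≤ j) (hjN : j ≤ N) (hp : 1 ≤ p)
    (hpi : p ≤ i) : upTerm N k a L i j p =
      if UpString N k a i j p L then (if i = k then resFactor 1 k (L k) p else 1) else 0 := by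
  split_ifs with hU hik
  · have h1 : ∏ m ∈ Icc i j, occ N k L (a - 1) m p = 1 := prod_eq_one fun m hm => by
      rw [mem_Icc] at hm
      exact occ_eq_one (by omega) (by omega) hp (by omega) (hU.eq m hm.1 hm.2)
    rw [upTerm, h1, occ_eq_zero fun _ h _ _ => hU.top h, occ_eq_zero fun h _ _ _ => by omega,
      if_pos hik]
    ring
  · have h1 : ∏ m ∈ Icc i j, occ N k L (a - 1) m p = 1 := prod_eq_one fun m hm => by
      rw [mem_Icc] at hm
      exact occ_eq_one (by omega) (by omega) hp (by omega) (hU.eq m hm.1 hm.2)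
    rw [upTerm, h1, occ_eq_zero fun _ h _ _ => hU.top h,
      occ_eq_zero fun h _ _ _ => hU.bot (by omega) (by omega), if_neg hik]
    ring
  · by_cases h1 : ∀ m, i ≤ m → m ≤ j → L m p = a - 1
    · by_cases h2 : j < N → L (j + 1) p ≠ a - 1
      · by_cases h3 : k < i → 1 < p → L (i - 1) (p - 1) ≠ a
        · have h4 : ¬(i = k → 1 < p → L k (p - 1) ≠ a) := fun h4 => hU ⟨h1, h2, h3, h4⟩
          push Not at h4
          obtain ⟨rfl, h5, h6⟩ := h4
          have := resFactor_eq_zero (u := 1) (n := i) (p := p) (q := p - 1) (x := L i) one_ne_zero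
            (by rw [mem_Icc]; omega) (by omega) (by rw [h6, h1 i le_rfl hij]; ring)
          rw [Int.cast_one] at this
          rw [upTerm, if_pos rfl, this]
          ring
        · push Not at h3
          obtain ⟨h4, h5, h6⟩ := h3
          rw [upTerm, occ_eq_one (m := i - 1) (p := p - 1) (by omega) (by omega) (by omega)
            (by omega) h6]
          ring
      · push Not at h2
        rw [upTerm, occ_eq_one (m := j + 1) (by omega) h2.1 hp (by omega) h2.2]
        ring
    · push Not at h1
      obtain ⟨m, h1, h2, h3⟩ := h1
      rw [upTerm, prod_eq_zero (f := fun m => occ N k L (a - 1) m p) (mem_Icc.2 ⟨h1, h2⟩)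
        (occ_eq_zero fun _ _ _ _ => h3)]
      ring

open Classical in
theorem downTerm_eq (hk : 1 ≤ k) (hki : k ≤ i) (hij : i ≤ j) (hjN : j ≤ N) (hp : 1 ≤ p)
    (hpi : p ≤ i) : downTerm N k a L i j p =
      if DownString N k a i j p L then (if j = N then resFactor (-1) N (L N) p else 1) else 0 := by
  split_ifs with hD hjN'
  · have h1 : ∏ m ∈ Icc i j, occ N k L a m p = 1 := prod_eq_one fun m hm => by
      rw [mem_Icc] at hm
      exact occ_eq_one (by omega) (by omega) hp (by omega) (hD.eq m hm.1 hm.2)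
    rw [downTerm, h1, occ_eq_zero fun h _ _ h' => hD.bot (by omega) h',
      occ_eq_zero fun _ h _ _ => by omega, if_pos hjN']
    ring
  · have h1 : ∏ m ∈ Icc i j, occ N k L a m p = 1 := prod_eq_one fun m hm => by
      rw [mem_Icc] at hm
      exact occ_eq_one (by omega) (by omega) hp (by omega) (hD.eq m hm.1 hm.2)
    rw [downTerm, h1, occ_eq_zero fun h _ _ h' => hD.bot (by omega) h',
      occ_eq_zero fun _ h _ _ => hD.top h, if_neg hjN']
    ring
  · by_cases h1 : ∀ m, i ≤ m → m ≤ j → L m p = a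
    · by_cases h2 : j < N → L (j + 1) (p + 1) ≠ a - 1
      · by_cases h3 : k < i → p ≤ i - 1 → L (i - 1) p ≠ a
        · have h4 : ¬(j = N → p + 1 ≤ N → L N (p + 1) ≠ a - 1) := fun h4 => hD ⟨h1, h2, h3, h4⟩
          push Not at h4
          obtain ⟨rfl, h5, h6⟩ := h4
          have := resFactor_eq_zero (u := -1) (n := j) (p := p) (q := p + 1) (x := L j) (by simp)
            (by rw [mem_Icc]; omega) (by omega) (by rw [h6, h1 j hij le_rfl]; ring)
          rw [Int.cast_neg, Int.cast_one] at this
          rw [downTerm, if_pos rfl, this]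
          ring
        · push Not at h3
          obtain ⟨h4, h5, h6⟩ := h3
          rw [downTerm, occ_eq_one (m := i - 1) (by omega) (by omega) hp h5 h6]
          ring
      · push Not at h2
        rw [downTerm, occ_eq_one (m := j + 1) (p := p + 1) (by omega) h2.1 (by omega) (by omega)
          h2.2]
        ring
    · push Not at h1
      obtain ⟨m, h1, h2, h3⟩ := h1
      rw [downTerm, prod_eq_zero (f := fun m => occ N k L a m p) (mem_Icc.2 ⟨h1, h2⟩)
        (occ_eq_zero fun _ _ _ _ => h3)]
      ring

/-- The jump from `a - 1` to `a` is a bijection between states having the up-string and states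
having the down-string, and it matches the weighted terms one by one. -/
theorem string_exchange (hk : 1 ≤ k) (hki : k ≤ i) (hij : i ≤ j) (hjN : j ≤ N) (hp : 1 ≤ p)
    (haN : -(N : ℤ) < a) (haM : a < M) {w : ℕ → ℝ → ℂ} {Φ : ℕ → ℂ}
    (hw : ∀ m, k ≤ m → m ≤ N → 1 - (m : ℤ) ≤ a → w m ((a : ℝ) - 1) ≠ 0)
    (hΦ : ∀ m, k ≤ m → m ≤ N → 1 - (m : ℤ) ≤ a →
      Φ (m + 1) * w m (a : ℝ) = Φ m * w m ((a : ℝ) - 1)) :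
    Φ i * ∑ A ∈ stateSpace N k M, weightEll N k w (ell A) * upTerm N k a (ell A) i j p =
      Φ (j + 1) *
        ∑ A ∈ stateSpace N k M, weightEll N k w (ell A) * downTerm N k a (ell A) i j p := by
  classical
  -- If `i < p` there is no `p`-th particle on level `i`, and both sides vanish.
  rcases lt_or_ge i p with hip | hpi
  · have h0 : ∀ (c : ℤ) (L : ℕ → ℕ → ℤ), ∏ m ∈ Icc i j, occ N k L c m p = 0 := fun c L =>
      prod_eq_zero (mem_Icc.2 ⟨le_rfl, hij⟩) (occ_eq_zero fun _ _ _ _ => by omega)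
    simp [upTerm, downTerm, h0]
  simp only [upTerm_eq hk hki hij hjN hp hpi, downTerm_eq hk hki hij hjN hp hpi,
    mul_ite (UpString _ _ _ _ _ _ _), mul_ite (DownString _ _ _ _ _ _ _),
    mul_zero, ← sum_filter, mul_sum]
  have move : ∀ {b c : ℤ} {A : Arr N k M},
      (∀ m, i ≤ m → m ≤ j → ell A m p = b) → Interlacing N k M (setString i j p c (ell A)) →
      StringMove N k b c i j p (ell A) (ell (ofEll N k M (setString i j p c (ell A)))) :=
    fun {b c A} h h' => (stringMove_setString c h).congr_right hki hjN hp hpi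
      fun j p h1 h2 h3 h4 => ell_ofEll h' h1 h2 h3 h4
  have up : ∀ A ∈ {A ∈ stateSpace N k M | UpString N k a i j p (ell A)},
      Interlacing N k M (setString i j p a (ell A)) ∧
      StringMove N k (a - 1) a i j p (ell A) (ell (ofEll N k M (setString i j p a (ell A)))) ∧
      DownString N k a i j p (ell (ofEll N k M (setString i j p a (ell A)))) := fun A hA => by
    rw [mem_filter, mem_stateSpace] at hA
    have h1 := hA.2.interlacing hA.1 (stringMove_setString a hA.2.eq) hki hij hjN hp hpi haM
    have h2 := move hA.2.eq h1
    exact ⟨h1, h2, hA.2.downString hA.1 h2 hki hij hjN hp hpi⟩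
  have down : ∀ A ∈ {A ∈ stateSpace N k M | DownString N k a i j p (ell A)},
      Interlacing N k M (setString i j p (a - 1) (ell A)) ∧
      StringMove N k a (a - 1) i j p (ell A)
        (ell (ofEll N k M (setString i j p (a - 1) (ell A)))) ∧
      UpString N k a i j p (ell (ofEll N k M (setString i j p (a - 1) (ell A)))) := fun A hA => by
    rw [mem_filter, mem_stateSpace] at hA
    have h1 := hA.2.interlacing hA.1 (stringMove_setString (a - 1) hA.2.eq) hki hij hjN hp hpi haN
    have h2 := move hA.2.eq h1
    exact ⟨h1, h2, hA.2.upString hA.1 h2 hki hij hjN hp hpi⟩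
  have up_mem : ∀ A ∈ {A ∈ stateSpace N k M | UpString N k a i j p (ell A)},
      ofEll N k M (setString i j p a (ell A)) ∈
        {A ∈ stateSpace N k M | DownString N k a i j p (ell A)} := fun A hA =>
    mem_filter.2 ⟨ofEll_mem (up A hA).1, (up A hA).2.2⟩
  have down_mem : ∀ A ∈ {A ∈ stateSpace N k M | DownString N k a i j p (ell A)},
      ofEll N k M (setString i j p (a - 1) (ell A)) ∈
        {A ∈ stateSpace N k M | UpString N k a i j p (ell A)} := fun A hA =>
    mem_filter.2 ⟨ofEll_mem (down A hA).1, (down A hA).2.2⟩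
  refine sum_nbij' (fun A => ofEll N k M (setString i j p a (ell A)))
    (fun A => ofEll N k M (setString i j p (a - 1) (ell A))) up_mem down_mem
    (fun A hA => ell_ext ((down _ (up_mem A hA)).2.1.unique (up A hA).2.1.symm))
    (fun A hA => ell_ext ((up _ (down_mem A hA)).2.1.unique (down A hA).2.1.symm))
    fun A hA => ?_
  have h1 := mem_stateSpace.1 (mem_filter.1 hA).1
  have h2 := mem_stateSpace.1 (mem_filter.1 (up_mem A hA)).1
  have hm := (up A hA).2.1
  -- A particle on level `m` at `a - 1` forces `a - 1 ≥ -m`, so the weights are only evaluated where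
  -- the hypotheses apply.
  have ham : ∀ m, i ≤ m → m ≤ j → 1 - (m : ℤ) ≤ a := fun m hm1 hm2 => by
    have h3 := hm.before m hm1 hm2
    have := h1.nonneg m p (by omega) (by omega) hp (by omega)
    omega
  exact hm.weight_eq h1 h2 hki hij hjN hp hpi
    (fun m hm1 hm2 => hw m (by omega) (by omega) (ham m hm1 hm2))
    (fun m hm1 hm2 => hΦ m (by omega) (by omega) (ham m hm1 hm2))

/-- A particle at `a - 1` on level `i` starts exactly one string that is maximal upwards, so the sum
over the top level `j` telescopes; it stops because `occ` vanishes on level `N + 1`. -/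
theorem sum_upTerm (hiN : i ≤ N) : ∑ j ∈ Icc i N, upTerm N k a L i j p =
    occ N k L (a - 1) i p *
      ((1 - occ N k L a (i - 1) (p - 1)) * if i = k then resFactor 1 k (L k) p else 1) := by
  simp only [upTerm, ← sum_mul]
  congr 1
  have key : ∀ n, i ≤ n → ∑ j ∈ Icc i n, (∏ m ∈ Icc i j, occ N k L (a - 1) m p) *
      (1 - occ N k L (a - 1) (j + 1) p) =
      occ N k L (a - 1) i p - ∏ m ∈ Icc i (n + 1), occ N k L (a - 1) m p := by
    intro n hn
    induction n, hn using Nat.le_induction with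
    | base =>
      rw [← insert_Icc_right_eq_Icc_add_one (by omega), prod_insert (by simp)]
      simp
      ring
    | succ n hn ih =>
      rw [← insert_Icc_right_eq_Icc_add_one (by omega), sum_insert (by simp), ih,
        ← insert_Icc_right_eq_Icc_add_one (b := n + 1) (by omega),
        prod_insert (s := Icc i (n + 1)) (by simp)]
      ring
  rw [key N hiN, prod_eq_zero (f := fun m => occ N k L (a - 1) m p) (i := N + 1)
    (by rw [mem_Icc]; omega)
    (occ_eq_zero fun _ h _ _ => by omega), sub_zero]

/-- Here strings are maximal downwards: each particle at `a` on level `j` ends exactly one of them,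
and `occ` vanishes on level `k - 1`. -/
theorem sum_downTerm (hk : 1 ≤ k) (hkj : k ≤ j) : ∑ i ∈ Icc k j, downTerm N k a L i j p =
    occ N k L a j p * ((1 - occ N k L (a - 1) (j + 1) (p + 1)) *
      if j = N then resFactor (-1) N (L N) p else 1) := by
  simp only [downTerm, ← sum_mul]
  congr 1
  have hz : occ N k L a (k - 1) p = 0 := occ_eq_zero fun h _ _ _ => by omega
  have key : ∀ n, k ≤ n → ∀ f : ℕ → ℂ, f (k - 1) = 0 →
      ∑ i ∈ Icc k n, (∏ m ∈ Icc i n, f m) * (1 - f (i - 1)) = f n := by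
    intro n hn f hf
    induction n, hn using Nat.le_induction with
    | base => simp [hf]
    | succ n hn ih =>
      rw [← insert_Icc_right_eq_Icc_add_one (by omega), sum_insert (by simp)]
      have : ∀ i ∈ Icc k n, (∏ m ∈ Icc i (n + 1), f m) * (1 - f (i - 1)) =
          f (n + 1) * ((∏ m ∈ Icc i n, f m) * (1 - f (i - 1))) := fun i hi => by
        rw [mem_Icc] at hi
        rw [← insert_Icc_right_eq_Icc_add_one (by omega), prod_insert (by simp)]
        ring
      rw [sum_congr rfl this, ← mul_sum, ih]
      simp
      ring
  exact key j hkj _ hz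

/-- Both sides count the blocking pairs: `a` on level `m - 1` next to `a - 1` on level `m`, with the
index one larger. They block an upward jump of the one and a downward jump of the other. -/
theorem sum_cross (N k : ℕ) (a : ℤ) (L : ℕ → ℕ → ℤ) (m : ℕ) :
    ∑ p ∈ Icc 1 N, occ N k L (a - 1) m p * occ N k L a (m - 1) (p - 1) =
      ∑ p ∈ Icc 1 N, occ N k L a (m - 1) p * occ N k L (a - 1) m (p + 1) := by
  have h1 : ∑ p ∈ Icc 1 N, occ N k L (a - 1) m p * occ N k L a (m - 1) (p - 1) =
      ∑ p ∈ range N, occ N k L (a - 1) m (p + 1) * occ N k L a (m - 1) p := by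
    rw [range_eq_Ico]
    exact (sum_Ico_add' (fun p => occ N k L (a - 1) m p * occ N k L a (m - 1) (p - 1)) 0 N 1).symm
  have h2 : ∀ f : ℕ → ℂ, f 0 = 0 → f N = 0 → ∑ p ∈ range N, f p = ∑ p ∈ Icc 1 N, f p := by
    intro f h0 hN
    have : Icc 1 N = Ico (0 + 1) (N + 1) := rfl
    rw [this, ← sum_Ico_add' f 0 N 1, ← range_eq_Ico]
    have := sum_range_succ f N
    rw [sum_range_succ'] at this
    rw [h0, hN] at this
    simpa using this.symm
  rw [h1, h2]
  · exact sum_congr rfl fun p _ => mul_comm _ _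
  · rw [occ_eq_zero (m := m - 1) fun _ _ h _ => by omega, mul_zero]
  · rw [occ_eq_zero (m := m) fun _ h _ h' => by omega, zero_mul]

/-- The residue at `a` contributed by a single configuration. -/
def residue (N k : ℕ) (Φ : ℕ → ℂ) (L : ℕ → ℕ → ℤ) (a : ℤ) : ℂ :=
  Φ (N + 1) * (-1 * ∑ p ∈ Icc 1 N, resFactor (-1) N (L N) p * (if L N p = a then 1 else 0)) +
    Φ k * ∑ p ∈ Icc 1 k, resFactor 1 k (L k) p * (if L k p = a - 1 then 1 else 0) +
    ∑ j ∈ Icc (k + 1) N, Φ j * (∑ p ∈ Icc 1 j, (if L j p = a - 1 then 1 else 0) -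
      ∑ p ∈ Icc 1 (j - 1), (if L (j - 1) p = a then 1 else 0))

/-- Summing over strings leaves unblocked particles at `a - 1` on level `j` minus unblocked
particles at `a` on level `j - 1`, with coefficient `Φ j`. The blocked ones may be restored on both
sides by `sum_cross`, giving the counts in the residue. -/
theorem residue_eq (hk : 1 ≤ k) (hkN : k ≤ N) (Φ : ℕ → ℂ) :
    residue N k Φ L a =
      ∑ p ∈ Icc 1 N, ∑ i ∈ Icc k N, ∑ j ∈ Icc i N,
        (Φ i * upTerm N k a L i j p - Φ (j + 1) * downTerm N k a L i j p) := by
  have hswap : ∑ p ∈ Icc 1 N, ∑ i ∈ Icc k N, ∑ j ∈ Icc i N,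
        (Φ i * upTerm N k a L i j p - Φ (j + 1) * downTerm N k a L i j p) =
      ∑ i ∈ Icc k N, Φ i * ∑ p ∈ Icc 1 N, ∑ j ∈ Icc i N, upTerm N k a L i j p -
      ∑ j ∈ Icc k N, Φ (j + 1) * ∑ p ∈ Icc 1 N, ∑ i ∈ Icc k j, downTerm N k a L i j p := by
    simp only [sum_sub_distrib, mul_sum]
    congr 1
    · exact sum_comm
    · rw [sum_comm' (t' := Icc k N) (s' := fun _ => Icc 1 N) (by simp)]
      have : ∀ p, ∑ i ∈ Icc k N, ∑ j ∈ Icc i N, Φ (j + 1) * downTerm N k a L i j p =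
          ∑ j ∈ Icc k N, ∑ i ∈ Icc k j, Φ (j + 1) * downTerm N k a L i j p := fun p =>
        sum_comm' (by simp; omega)
      rw [sum_comm, sum_congr rfl fun p _ => this p, sum_comm]
  rw [hswap]
  have hU : ∀ i ∈ Icc k N, Φ i * ∑ p ∈ Icc 1 N, ∑ j ∈ Icc i N, upTerm N k a L i j p =
      Φ i * ∑ p ∈ Icc 1 N, occ N k L (a - 1) i p * ((1 - occ N k L a (i - 1) (p - 1)) *
        if i = k then resFactor 1 k (L k) p else 1) := fun i hi => by
    rw [sum_congr rfl fun p _ => sum_upTerm (mem_Icc.1 hi).2]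
  have hD : ∀ j ∈ Icc k N, Φ (j + 1) * ∑ p ∈ Icc 1 N, ∑ i ∈ Icc k j, downTerm N k a L i j p =
      Φ (j + 1) * ∑ p ∈ Icc 1 N, occ N k L a j p * ((1 - occ N k L (a - 1) (j + 1) (p + 1)) *
        if j = N then resFactor (-1) N (L N) p else 1) := fun j hj => by
    rw [sum_congr rfl fun p _ => sum_downTerm hk (mem_Icc.1 hj).1]
  rw [sum_congr rfl hU, sum_congr rfl hD]
  have s1 : Icc k N = insert k (Icc (k + 1) N) := (insert_Icc_add_one_left_eq_Icc hkN).symm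
  -- Down-strings topped at level `j` carry `Φ (j + 1)`; reindexing by the coefficient aligns them
  -- with up-strings from level `j + 1` and leaves `Φ (N + 1)` for the top product.
  have s2 : ∀ f : ℕ → ℂ, ∑ j ∈ Icc k N, f (j + 1) = ∑ j ∈ Icc (k + 1) N, f j + f (N + 1) := by
    intro f
    have e1 : Icc k N = Ico k (N + 1) := rfl
    have e2 : Icc (k + 1) N = Ico (k + 1) (N + 1) := rfl
    rw [e1, e2, sum_Ico_add' f k (N + 1) 1, sum_Ico_succ_top (by omega)]
  have hD' : ∀ j ∈ Icc k N, Φ (j + 1) * ∑ p ∈ Icc 1 N, occ N k L a j p *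
      ((1 - occ N k L (a - 1) (j + 1) (p + 1)) *
        if j = N then resFactor (-1) N (L N) p else 1) =
      (fun j => Φ j * ∑ p ∈ Icc 1 N, occ N k L a (j - 1) p * ((1 - occ N k L (a - 1) j (p + 1)) *
        if j = N + 1 then resFactor (-1) N (L N) p else 1)) (j + 1) := fun j _ => by
    simp
  rw [sum_congr rfl hD', s2 (fun j => Φ j * ∑ p ∈ Icc 1 N, occ N k L a (j - 1) p *
    ((1 - occ N k L (a - 1) j (p + 1)) * if j = N + 1 then resFactor (-1) N (L N) p else 1)), s1,
    sum_insert (by simp)]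
  have t1 : Φ k * ∑ p ∈ Icc 1 N, occ N k L (a - 1) k p * ((1 - occ N k L a (k - 1) (p - 1)) *
      if k = k then resFactor 1 k (L k) p else 1) =
      Φ k * ∑ p ∈ Icc 1 k, resFactor 1 k (L k) p * (if L k p = a - 1 then 1 else 0) := by
    rw [← sum_occ_mul le_rfl hkN]
    congr 1
    refine sum_congr rfl fun p _ => ?_
    rw [occ_eq_zero (m := k - 1) fun _ _ _ _ => by omega, if_pos rfl]
    ring
  have t2 : Φ (N + 1) * ∑ p ∈ Icc 1 N, occ N k L a (N + 1 - 1) p *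
      ((1 - occ N k L (a - 1) (N + 1) (p + 1)) *
        if N + 1 = N + 1 then resFactor (-1) N (L N) p else 1) =
      Φ (N + 1) * ∑ p ∈ Icc 1 N, resFactor (-1) N (L N) p * (if L N p = a then 1 else 0) := by
    rw [← sum_occ_mul hkN le_rfl]
    congr 1
    refine sum_congr rfl fun p _ => ?_
    rw [occ_eq_zero (m := N + 1) fun _ _ _ _ => by omega, if_pos rfl, Nat.add_sub_cancel]
    ring
  have t3 : ∑ j ∈ Icc (k + 1) N, Φ j * (∑ p ∈ Icc 1 j, (if L j p = a - 1 then 1 else 0) -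
      ∑ p ∈ Icc 1 (j - 1), (if L (j - 1) p = a then 1 else 0)) =
      ∑ j ∈ Icc (k + 1) N, Φ j * ∑ p ∈ Icc 1 N, occ N k L (a - 1) j p *
        ((1 - occ N k L a (j - 1) (p - 1)) * if j = k then resFactor 1 k (L k) p else 1) -
      ∑ j ∈ Icc (k + 1) N, Φ j * ∑ p ∈ Icc 1 N, occ N k L a (j - 1) p *
        ((1 - occ N k L (a - 1) j (p + 1)) *
          if j = N + 1 then resFactor (-1) N (L N) p else 1) := by
    rw [← sum_sub_distrib]
    refine sum_congr rfl fun j hj => ?_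
    rw [mem_Icc] at hj
    rw [← mul_sub, ← sum_occ (N := N) (k := k) (by omega) hj.2,
      ← sum_occ (N := N) (k := k) (by omega) (by omega)]
    simp only [if_neg (show j ≠ k by omega), if_neg (show j ≠ N + 1 by omega), mul_one, mul_sub,
      sum_sub_distrib]
    rw [sum_cross N k a L j]
    ring
  rw [residue, t3, t1]
  linear_combination t2

theorem sum_residue_interior (hk : 1 ≤ k) (hkN : k ≤ N)
    (haN : -(N : ℤ) < a) (haM : a < M) {w : ℕ → ℝ → ℂ} {Φ : ℕ → ℂ}
    (hw : ∀ m, k ≤ m → m ≤ N → 1 - (m : ℤ) ≤ a → w m ((a : ℝ) - 1) ≠ 0)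
    (hΦ : ∀ m, k ≤ m → m ≤ N → 1 - (m : ℤ) ≤ a →
      Φ (m + 1) * w m (a : ℝ) = Φ m * w m ((a : ℝ) - 1)) :
    ∑ A ∈ stateSpace N k M, weightEll N k w (ell A) * residue N k Φ (ell A) a = 0 := by
  simp only [residue_eq hk hkN, mul_sum]
  rw [sum_comm]
  refine sum_eq_zero fun p hp => ?_
  rw [sum_comm]
  refine sum_eq_zero fun i hi => ?_
  rw [sum_comm]
  refine sum_eq_zero fun j hj => ?_
  rw [mem_Icc] at hp hi hj
  have := string_exchange (M := M) hk hi.1 hj.1 hj.2 hp.1 haN haM hw hΦ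
  rw [mul_sum, mul_sum] at this
  rw [← sub_eq_zero, ← sum_sub_distrib] at this
  rw [← this]
  exact sum_congr rfl fun A _ => by ring

end

/-! ### Boundary residues and the first equation -/

section

variable {N k M : ℕ}

theorem expect_congr {w : ℕ → ℝ → ℂ} {f g : Arr N k M → ℂ}
    (h : ∀ A ∈ stateSpace N k M, f A = g A) : expect 1 w f = expect 1 w g :=
  sum_congr rfl fun A hA => by rw [h A hA]

theorem expect_add (w : ℕ → ℝ → ℂ) (f g : Arr N k M → ℂ) :
    expect 1 w (fun A => f A + g A) = expect 1 w f + expect 1 w g := by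
  simp only [expect, mul_add, sum_add_distrib]

theorem expect_const_mul (w : ℕ → ℝ → ℂ) (c : ℂ) (f : Arr N k M → ℂ) :
    expect 1 w (fun A => c * f A) = c * expect 1 w f := by
  simp only [expect, mul_sum]
  exact sum_congr rfl fun A _ => by ring

theorem expect_sum {ι : Type*} (w : ℕ → ℝ → ℂ) (s : Finset ι) (f : ι → Arr N k M → ℂ) :
    expect 1 w (fun A => ∑ i ∈ s, f i A) = ∑ i ∈ s, expect 1 w (f i) := by
  simp only [expect, mul_sum]
  exact sum_comm

theorem HasPolarPart.expect {𝓜 : Set ℂ} {S : Finset ℤ} (h𝓜 : IsOpen 𝓜)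
    (hS : ∀ n ∈ S, (n : ℂ) ∈ 𝓜) (w : ℕ → ℝ → ℂ) {f : Arr N k M → ℂ → ℂ}
    {c : Arr N k M → ℤ → ℂ} (h : ∀ A ∈ stateSpace N k M, HasPolarPart 𝓜 S (f A) (c A)) :
    HasPolarPart 𝓜 S (fun z => BetaCorners.expect 1 w (fun A => f A z))
      (fun n => BetaCorners.expect 1 w (fun A => c A n)) :=
  HasPolarPart.sum _ fun A hA => (h A hA).const_mul (prob 1 w A) h𝓜 hS

namespace Interlacing

variable {L : ℕ → ℕ → ℤ}

theorem mem_poles (h : Interlacing N k M L) {j p : ℕ} (hk : k ≤ j) (hN : j ≤ N)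
    (hp : p ∈ Icc 1 j) : L j p ∈ Icc (-(N : ℤ)) M ∧ L j p + 1 ∈ Icc (-(N : ℤ)) M := by
  rw [mem_Icc] at hp
  have h1 := h.nonneg j p hk hN hp.1 hp.2
  have h2 := h.le_top j p hk hN hp.1 hp.2
  rw [mem_Icc, mem_Icc]
  omega

/-- Since `ℓ^j_p ≤ M - p`, no particle sits at `M`, and only the first one on a level can sit at `M
- 1`. -/
theorem residue_right (h : Interlacing N k M L) (hk : 1 ≤ k) (hkN : k ≤ N) (Φ : ℕ → ℂ) :
    residue N k Φ L M =
      Φ k * ((∏ p ∈ Icc 2 k, ((M : ℂ) - L k p) / ((M : ℂ) - L k p - 1)) *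
        (if L k 1 = (M : ℤ) - 1 then 1 else 0)) +
      ∑ j ∈ Icc (k + 1) N, Φ j * (if L j 1 = (M : ℤ) - 1 then 1 else 0) := by
  have hlt : ∀ {j p : ℕ}, k ≤ j → j ≤ N → p ∈ Icc 1 j → L j p ≠ M := fun {j p} h1 h2 hp => by
    rw [mem_Icc] at hp
    have := h.le_top j p h1 h2 hp.1 hp.2
    omega
  have hlt' : ∀ {j p : ℕ}, k ≤ j → j ≤ N → p ∈ Icc 1 j → p ≠ 1 → L j p ≠ (M : ℤ) - 1 :=
    fun {j p} h1 h2 hp _ => by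
      rw [mem_Icc] at hp
      have := h.le_top j p h1 h2 hp.1 hp.2
      omega
  rw [residue, sum_eq_zero fun p hp => by rw [if_neg (hlt hkN le_rfl hp), mul_zero], mul_zero,
    mul_zero, zero_add]
  congr 1
  · rw [sum_eq_single 1]
    · congr 1
      split_ifs with h1
      · congr 1
        have : (Icc 1 k).erase 1 = Icc 2 k := by ext q; simp; omega
        rw [resFactor, this]
        refine prod_congr rfl fun q hq => ?_
        rw [mem_Icc] at hq
        have h2 := h.le_top k q le_rfl hkN (by omega) hq.2
        have h3 : (M : ℂ) - L k q - 1 ≠ 0 := by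
          have : (M : ℤ) - L k q - 1 ≠ 0 := by omega
          exact_mod_cast this
        have h4 : (M : ℂ) - 1 - L k q ≠ 0 := by rwa [sub_right_comm]
        rw [h1]
        push_cast
        field_simp
        ring
      · rw [mul_zero, mul_zero]
    · intro p hp hp1
      rw [if_neg (hlt' le_rfl hkN hp hp1), mul_zero]
    · intro h1
      exact absurd (mem_Icc.2 ⟨le_rfl, hk⟩) h1
  · refine sum_congr rfl fun j hj => ?_
    rw [mem_Icc] at hj
    rw [sum_eq_zero (s := Icc 1 (j - 1))
      fun p hp => if_neg (hlt (j := j - 1) (by omega) (by omega) hp), sub_zero, sum_eq_single 1]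
    · intro p hp hp1
      rw [if_neg (hlt' (by omega) hj.2 hp hp1)]
    · intro h1
      exact absurd (mem_Icc.2 ⟨le_rfl, by omega⟩) h1

/-- Since `ℓ^j_p ≥ -p`, no particle sits at `-N - 1`, and only the last one of level `N` can sit at
`-N`. -/
theorem residue_left (h : Interlacing N k M L) (hk : 1 ≤ k) (hkN : k ≤ N) (Φ : ℕ → ℂ) :
    residue N k Φ L (-(N : ℤ)) =
      -1 * Φ (N + 1) * ((∏ p ∈ Icc 1 (N - 1), ((L N p : ℂ) + N + 1) / ((L N p : ℂ) + N)) *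
        (if L N N = -(N : ℤ) then 1 else 0)) := by
  have hlt : ∀ {j p : ℕ}, k ≤ j → j ≤ N → p ∈ Icc 1 j → L j p ≠ -(N : ℤ) - 1 :=
    fun {j p} h1 h2 hp => by
      rw [mem_Icc] at hp
      have := h.nonneg j p h1 h2 hp.1 hp.2
      omega
  have hlt' : ∀ {j p : ℕ}, k ≤ j → j ≤ N → p ∈ Icc 1 j → p ≠ N → L j p ≠ -(N : ℤ) :=
    fun {j p} h1 h2 hp _ => by
      rw [mem_Icc] at hp
      have := h.nonneg j p h1 h2 hp.1 hp.2
      omega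
  have h3 : ∑ j ∈ Icc (k + 1) N,
      Φ j * (∑ p ∈ Icc 1 j, (if L j p = -(N : ℤ) - 1 then 1 else 0) -
        ∑ p ∈ Icc 1 (j - 1), (if L (j - 1) p = -(N : ℤ) then 1 else 0)) = 0 := by
    refine sum_eq_zero fun j hj => ?_
    rw [mem_Icc] at hj
    rw [sum_eq_zero fun p hp => if_neg (hlt (by omega) hj.2 hp),
      sum_eq_zero fun p hp => if_neg (hlt' (j := j - 1) (by omega) (by omega) hp ?_), sub_zero,
      mul_zero]
    rw [mem_Icc] at hp
    omega
  rw [residue, h3, sum_eq_zero (s := Icc 1 k)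
    fun p hp => by rw [if_neg (hlt le_rfl hkN hp), mul_zero], mul_zero, add_zero, add_zero,
    sum_eq_single N]
  · rw [← mul_assoc, mul_comm (Φ (N + 1))]
    congr 1
    split_ifs with h1
    · congr 1
      have : (Icc 1 N).erase N = Icc 1 (N - 1) := by ext q; simp; omega
      rw [resFactor, this]
      refine prod_congr rfl fun q hq => ?_
      rw [mem_Icc] at hq
      have h2 := h.nonneg N q hkN le_rfl hq.1 (by omega)
      have h3 : (L N q : ℂ) + N ≠ 0 := by
        have : L N q + (N : ℤ) ≠ 0 := by omega
        exact_mod_cast this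
      have h4 : ((L N N : ℤ) : ℂ) - L N q = -((L N q : ℂ) + N) := by
        rw [h1]; push_cast; ring
      rw [h4]
      field_simp
    · rw [mul_zero, mul_zero]
  · intro p hp hpN
    rw [if_neg (hlt' hkN le_rfl hp hpN), mul_zero]
  · intro h1
    exact absurd (mem_Icc.2 ⟨by omega, le_rfl⟩) h1

end Interlacing

theorem loc_one_complex (A : Arr N k M) (j p : ℕ) : (loc 1 A j p : ℂ) = (ell A j p : ℂ) := by
  rw [loc_one]; norm_cast

theorem loc_one_eq_iff (A : Arr N k M) (j p : ℕ) (n : ℤ) :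
    loc 1 A j p = (n : ℝ) ↔ ell A j p = n := by
  rw [loc_one]; norm_cast

/-- The polar part of the three expectations in the first observable. -/
theorem hasPolarPart_expectations (hkN : k ≤ N) {𝓜 : Set ℂ} (h𝓜 : IsOpen 𝓜)
    (hS : ∀ n ∈ Icc (-(N : ℤ)) M, (n : ℂ) ∈ 𝓜) (w : ℕ → ℝ → ℂ) {φ : ℕ → ℂ → ℂ}
    (hφ : ∀ j ∈ Icc k (N + 1), AnalyticOnNhd ℂ (φ j) 𝓜) :
    HasPolarPart 𝓜 (Icc (-(N : ℤ)) M)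
      (fun z => φ (N + 1) z *
          expect 1 w (fun A : Arr N k M =>
            ∏ p ∈ Icc 1 N, (z - loc 1 A N p - 1) / (z - loc 1 A N p)) +
        φ k z *
          expect 1 w (fun A : Arr N k M =>
            ∏ p ∈ Icc 1 k, (z - loc 1 A k p) / (z - loc 1 A k p - 1)) +
        ∑ j ∈ Icc (k + 1) N, φ j z *
          expect 1 w (fun A : Arr N k M =>
            ∑ p ∈ Icc 1 j, 1 / (z - loc 1 A j p - 1) -
              ∑ p ∈ Icc 1 (j - 1), 1 / (z - loc 1 A (j - 1) p)))
      (fun n => expect 1 w (fun A : Arr N k M => residue N k (fun j => φ j n) (ell A) n)) := by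
  have top : ∀ A ∈ stateSpace N k M, HasPolarPart 𝓜 (Icc (-(N : ℤ)) M)
      (fun z => ∏ p ∈ Icc 1 N, (z - loc 1 A N p - 1) / (z - loc 1 A N p))
      (fun n => -1 * ∑ p ∈ Icc 1 N, resFactor (-1) N (ell A N) p *
        (if ell A N p = n then 1 else 0)) := fun A hA => by
    have h := mem_stateSpace.1 hA
    refine (hasPolarPart_prod h𝓜 hS (-1) 0 N (ell A N) (h.injOn hkN le_rfl)
      fun p hp => ?_).congr (fun z _ hn => prod_congr rfl fun p hp => ?_) fun n _ => ?_
    · simpa using (h.mem_poles hkN le_rfl hp).1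
    · have h1 : z - (ell A N p : ℂ) ≠ 0 := sub_ne_zero.2 (hn _ (h.mem_poles hkN le_rfl hp).1)
      rw [loc_one_complex, add_zero]
      field_simp
      ring
    · simp only [add_zero]
  have bot : ∀ A ∈ stateSpace N k M, HasPolarPart 𝓜 (Icc (-(N : ℤ)) M)
      (fun z => ∏ p ∈ Icc 1 k, (z - loc 1 A k p) / (z - loc 1 A k p - 1))
      (fun n => ∑ p ∈ Icc 1 k, resFactor 1 k (ell A k) p *
        (if ell A k p = n - 1 then 1 else 0)) := fun A hA => by
    have h := mem_stateSpace.1 hA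
    refine (hasPolarPart_prod h𝓜 hS 1 1 k (ell A k) (h.injOn le_rfl hkN)
      fun p hp => (h.mem_poles le_rfl hkN hp).2).congr
      (fun z _ hn => prod_congr rfl fun p hp => ?_) fun n _ => ?_
    · have h1 : z - ((ell A k p + 1 : ℤ) : ℂ) ≠ 0 :=
        sub_ne_zero.2 (hn _ (h.mem_poles le_rfl hkN hp).2)
      have h2 : z - (ell A k p : ℂ) - 1 = z - ((ell A k p + 1 : ℤ) : ℂ) := by push_cast; ring
      rw [loc_one_complex, h2]
      field_simp
      push_cast
      ring
    · simp only [eq_sub_iff_add_eq, one_mul]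
  have mid : ∀ j ∈ Icc (k + 1) N, ∀ A ∈ stateSpace N k M, HasPolarPart 𝓜 (Icc (-(N : ℤ)) M)
      (fun z => ∑ p ∈ Icc 1 j, 1 / (z - loc 1 A j p - 1) -
        ∑ p ∈ Icc 1 (j - 1), 1 / (z - loc 1 A (j - 1) p))
      (fun n => ∑ p ∈ Icc 1 j, (if ell A j p = n - 1 then 1 else 0) -
        ∑ p ∈ Icc 1 (j - 1), (if ell A (j - 1) p = n then 1 else 0)) := fun j hj A hA => by
    rw [mem_Icc] at hj
    have h := mem_stateSpace.1 hA
    refine ((HasPolarPart.sum (Icc 1 j) fun p hp => HasPolarPart.one_div_sub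
      (h.mem_poles (j := j) (by omega) hj.2 hp).2).add
      ((HasPolarPart.sum (Icc 1 (j - 1)) fun p hp => HasPolarPart.one_div_sub
      (h.mem_poles (j := j - 1) (by omega) (by omega) hp).1).const_mul (-1) h𝓜 hS)).congr
      (fun z _ _ => ?_) fun n _ => ?_
    · simp only [loc_one_complex, Int.cast_add, Int.cast_one, sub_sub]
      ring
    · simp only [eq_sub_iff_add_eq]
      ring
  refine ((((HasPolarPart.expect h𝓜 hS w top).mul_left (hφ _ ?_) h𝓜 hS).add
    ((HasPolarPart.expect h𝓜 hS w bot).mul_left (hφ _ ?_) h𝓜 hS)).add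
    (HasPolarPart.sum _ fun j hj =>
      (HasPolarPart.expect h𝓜 hS w (mid j hj)).mul_left (hφ j ?_) h𝓜 hS)).congr
    (fun _ _ _ => rfl) fun n _ => ?_
  · simp; omega
  · simp; omega
  · simp at hj ⊢; omega
  · simp only [residue]
    rw [expect_add, expect_add, expect_sum]
    simp only [expect_const_mul]

theorem hasPolarPart_Res₁ {𝓜 : Set ℂ} (h𝓜 : IsOpen 𝓜)
    (hS : ∀ n ∈ Icc (-(N : ℤ)) M, (n : ℂ) ∈ 𝓜) (w : ℕ → ℝ → ℂ) (φ : ℕ → ℂ → ℂ) :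
    HasPolarPart 𝓜 (Icc (-(N : ℤ)) M) (Res₁ N k M w φ) (fun n =>
      (if -(N : ℤ) = n then -1 * φ (N + 1) (-(N : ℂ)) * expect 1 w (fun A : Arr N k M =>
        (∏ p ∈ Icc 1 (N - 1), ((ell A N p : ℂ) + N + 1) / ((ell A N p : ℂ) + N)) *
          (if ell A N N = -(N : ℤ) then 1 else 0)) else 0) +
      (if (M : ℤ) = n then φ k (M : ℂ) * expect 1 w (fun A : Arr N k M =>
        (∏ p ∈ Icc 2 k, ((M : ℂ) - ell A k p) / ((M : ℂ) - ell A k p - 1)) *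
          (if ell A k 1 = (M : ℤ) - 1 then 1 else 0)) +
        ∑ j ∈ Icc (k + 1) N, φ j (M : ℂ) * expect 1 w (fun A : Arr N k M =>
          if ell A j 1 = (M : ℤ) - 1 then 1 else 0) else 0)) := by
  have hN : HasPolarPart 𝓜 (Icc (-(N : ℤ)) M) _ _ :=
    HasPolarPart.one_div_sub (b := -(N : ℤ)) (by rw [mem_Icc]; omega)
  have hM : HasPolarPart 𝓜 (Icc (-(N : ℤ)) M) _ _ :=
    HasPolarPart.one_div_sub (b := (M : ℤ)) (by rw [mem_Icc]; omega)
  refine ((hN.const_mul (-1 * φ (N + 1) (-(N : ℂ)) * expect 1 w (fun A : Arr N k M =>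
        (∏ p ∈ Icc 1 (N - 1), ((ell A N p : ℂ) + N + 1) / ((ell A N p : ℂ) + N)) *
          (if ell A N N = -(N : ℤ) then 1 else 0))) h𝓜 hS).add
    (hM.const_mul (φ k (M : ℂ) * expect 1 w (fun A : Arr N k M =>
        (∏ p ∈ Icc 2 k, ((M : ℂ) - ell A k p) / ((M : ℂ) - ell A k p - 1)) *
          (if ell A k 1 = (M : ℤ) - 1 then 1 else 0)) +
        ∑ j ∈ Icc (k + 1) N, φ j (M : ℂ) * expect 1 w (fun A : Arr N k M =>
          if ell A j 1 = (M : ℤ) - 1 then 1 else 0)) h𝓜 hS)).congr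
    (fun z _ _ => ?_) fun n _ => ?_
  · have e1 : ∀ A : Arr N k M, loc 1 A N N = -(N : ℝ) ↔ ell A N N = -(N : ℤ) := fun A => by
      rw [← loc_one_eq_iff]; push_cast; rfl
    have e2 : ∀ (A : Arr N k M) j, loc 1 A j 1 = (M : ℝ) - 1 ↔ ell A j 1 = (M : ℤ) - 1 :=
      fun A j => by
        rw [← loc_one_eq_iff]; push_cast; rfl
    simp only [Res₁, loc_one_complex, e1, e2, Int.cast_neg, Int.cast_natCast, sub_neg_eq_add,
      add_mul, sum_mul, add_assoc]
    congr 1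
    · ring
    congr 1
    · ring
    · exact sum_congr rfl fun j _ => by ring
  · split_ifs <;> simp

theorem exists_analytic_eq_R₁ (hk : 1 ≤ k) (hkN : k ≤ N) {w : ℕ → ℝ → ℂ}
    (hw : ∀ j ∈ Icc k N, ∀ x ∈ Set.Icc (-(j : ℝ)) ((M : ℝ) - 1), w j x ≠ 0)
    {𝓜 : Set ℂ} (h𝓜 : IsOpen 𝓜) (hsub : ∀ x ∈ Set.Icc (-(N : ℝ)) (M : ℝ), (x : ℂ) ∈ 𝓜)
    {φ : ℕ → ℂ → ℂ} (hφ : ∀ j ∈ Icc k (N + 1), AnalyticOnNhd ℂ (φ j) 𝓜)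
    (hratio : ∀ j ∈ Icc k N, ∀ x ∈ Set.Icc (1 - (j : ℝ)) ((M : ℝ) - 1),
      φ (j + 1) (x : ℂ) / φ j (x : ℂ) = w j (x - 1) / w j x) :
    ∃ F : ℂ → ℂ, AnalyticOnNhd ℂ F 𝓜 ∧
      ∀ z ∈ 𝓜, (∀ n ∈ Set.Icc (-(N : ℤ)) (M : ℤ), z ≠ (n : ℂ)) → F z = R₁ N k M w φ z := by
  have hS : ∀ n ∈ Icc (-(N : ℤ)) M, (n : ℂ) ∈ 𝓜 := fun n hn => by
    rw [mem_Icc] at hn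
    have h1 : (n : ℝ) ∈ Set.Icc (-(N : ℝ)) (M : ℝ) :=
      ⟨by exact_mod_cast hn.1, by exact_mod_cast hn.2⟩
    simpa using hsub n h1
  have hpolar : HasPolarPart 𝓜 (Icc (-(N : ℤ)) M) (R₁ N k M w φ) (fun _ => 0) := by
    refine ((hasPolarPart_expectations hkN h𝓜 hS w hφ).add
      ((hasPolarPart_Res₁ h𝓜 hS w φ).const_mul (-1) h𝓜 hS)).congr
      (fun z _ _ => by rw [R₁]; ring) fun n hn => ?_
    rw [mem_Icc] at hn
    rcases hn.1.eq_or_lt with h1 | h1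
    · subst h1
      rw [if_pos rfl, if_neg (by omega), expect_congr fun A hA =>
        (mem_stateSpace.1 hA).residue_left hk hkN _, expect_const_mul]
      push_cast
      ring
    rcases hn.2.eq_or_lt with h2 | h2
    · subst h2
      rw [if_neg (by omega), if_pos rfl, expect_congr fun A hA =>
        (mem_stateSpace.1 hA).residue_right hk hkN _, expect_add, expect_const_mul, expect_sum]
      simp only [expect_const_mul]
      push_cast
      ring
    · rw [if_neg (by omega), if_neg (by omega)]
      have hmem : ∀ m : ℕ, 1 - (m : ℤ) ≤ n → (n : ℝ) ∈ Set.Icc (1 - (m : ℝ)) ((M : ℝ) - 1) :=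
        fun m hm => by
          have h3 : n ≤ (M : ℤ) - 1 := by omega
          exact ⟨by exact_mod_cast hm, by exact_mod_cast h3⟩
      have hw0 : ∀ m, k ≤ m → m ≤ N → 1 - (m : ℤ) ≤ n → w m ((n : ℝ) - 1) ≠ 0 :=
        fun m h3 h4 h5 => hw m (mem_Icc.2 ⟨h3, h4⟩) _
          ⟨by linarith [(hmem m h5).1], by linarith [(hmem m h5).2]⟩
      have hw1 : ∀ m, k ≤ m → m ≤ N → 1 - (m : ℤ) ≤ n → w m (n : ℝ) ≠ 0 :=
        fun m h3 h4 h5 => hw m (mem_Icc.2 ⟨h3, h4⟩) _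
          ⟨by linarith [(hmem m h5).1], (hmem m h5).2⟩
      have key := sum_residue_interior (M := M) (Φ := fun j => φ j n) (w := w) hk hkN h1 h2 hw0
        fun m h3 h4 h5 => by
          have h6 := hratio m (mem_Icc.2 ⟨h3, h4⟩) n (hmem m h5)
          rw [Complex.ofReal_intCast] at h6
          -- Division by zero gives `0`, so a zero of `φ m` at `n` would contradict the nonzero
          -- ratio of weights; no separate assumption on denominators is needed.
          have h7 : φ m n ≠ 0 := fun h => div_ne_zero (hw0 m h3 h4 h5) (hw1 m h3 h4 h5)
            (by rw [← h6, h, div_zero])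
          rw [div_eq_div_iff h7 (hw1 m h3 h4 h5)] at h6
          rw [h6, mul_comm]
      have : expect 1 w (fun A : Arr N k M => residue N k (fun j => φ j n) (ell A) n) =
          (Z N k M 1 w)⁻¹ * ∑ A ∈ stateSpace N k M,
            weightEll N k w (ell A) * residue N k (fun j => φ j n) (ell A) n := by
        rw [expect, mul_sum]
        refine sum_congr rfl fun A hA => ?_
        rw [prob, weight_one hA hkN, weightEll]
        ring
      rw [this, key]
      ring
  obtain ⟨g, hg, h⟩ := hpolar
  refine ⟨g, hg, fun z hz hn => ?_⟩
  rw [h z hz fun n hnS => hn n (by simpa using hnS)]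
  simp

end

/-! ### Reflection and the second equation -/

section

variable {N k M : ℕ}

theorem prod_Icc_reflect (n : ℕ) (f : ℕ → ℂ) :
    ∏ p ∈ Icc 1 n, f (n + 1 - p) = ∏ p ∈ Icc 1 n, f p := by
  refine prod_nbij' (fun p => n + 1 - p) (fun p => n + 1 - p) ?_ ?_ ?_ ?_ fun _ _ => rfl <;>
  · intro p hp
    simp only [mem_Icc] at hp ⊢
    omega

theorem sum_Icc_reflect (n : ℕ) (f : ℕ → ℂ) :
    ∑ p ∈ Icc 1 n, f (n + 1 - p) = ∑ p ∈ Icc 1 n, f p := by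
  refine sum_nbij' (fun p => n + 1 - p) (fun p => n + 1 - p) ?_ ?_ ?_ ?_ fun _ _ => rfl <;>
  · intro p hp
    simp only [mem_Icc] at hp ⊢
    omega

/-- Reversing both the order and the sign preserves each ordered difference: the pair `(p, q)`
corresponds to `(n + 1 - q, n + 1 - p)`, and `c` drops out. -/
theorem vand_reflect (n : ℕ) (c : ℤ) (x : ℕ → ℤ) :
    vand n (fun p => c - x (n + 1 - p)) = vand n x := by
  rw [vand, vand, prod_sigma', prod_sigma']
  refine prod_nbij' (fun s => ⟨n + 1 - s.2, n + 1 - s.1⟩) (fun s => ⟨n + 1 - s.2, n + 1 - s.1⟩)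
    ?_ ?_ ?_ ?_ ?_
  · rintro ⟨p, q⟩ h
    simp only [mem_sigma, mem_Icc, mem_Ioc] at h ⊢
    omega
  · rintro ⟨p, q⟩ h
    simp only [mem_sigma, mem_Icc, mem_Ioc] at h ⊢
    omega
  · rintro ⟨p, q⟩ h
    simp only [mem_sigma, mem_Icc, mem_Ioc] at h
    ext <;> simp <;> omega
  · rintro ⟨p, q⟩ h
    simp only [mem_sigma, mem_Icc, mem_Ioc] at h
    ext <;> simp <;> omega
  · rintro ⟨p, q⟩ _
    push_cast
    ring

/-- Particle locations after the reflection `λ^j_p ↦ M - λ^j_{j+1-p}`. -/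
def reflectEll (M : ℕ) (L : ℕ → ℕ → ℤ) : ℕ → ℕ → ℤ := fun j p =>
  (M : ℤ) - j - 1 - L j (j + 1 - p)

/-- The weight functions after the reflection `λ^j_p ↦ M - λ^j_{j+1-p}`. -/
def reflectWeight (M : ℕ) (w : ℕ → ℝ → ℂ) : ℕ → ℝ → ℂ := fun j x => w j ((M : ℝ) - j - 1 - x)

/-- The reflection `λ^j_p ↦ M - λ^j_{j+1-p}` of an array. -/
def reflect (A : Arr N k M) : Arr N k M := ofEll N k M (reflectEll M (ell A))

theorem Interlacing.reflectEll {L : ℕ → ℕ → ℤ} (h : Interlacing N k M L) :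
    Interlacing N k M (reflectEll M L) := by
  refine ⟨?_, ?_, ?_, ?_, ?_⟩ <;> intro j p h1 h2 h3 h4 <;> simp only [BetaCorners.reflectEll]
  · have := h.le_top j (j + 1 - p) h1 h2 (by omega) (by omega)
    omega
  · have := h.nonneg j (j + 1 - p) h1 h2 (by omega) (by omega)
    omega
  · have := h.strict j (j - p) h1 h2 (by omega) (by omega)
    rw [show j - p + 1 = j + 1 - p by omega] at this
    rw [show j + 1 - (p + 1) = j - p by omega]
    omega
  · have := h.succ_lt j (j + 1 - p) h1 h2 (by omega) (by omega)
    rw [show j + 1 - p + 1 = j + 1 + 1 - p by omega] at this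
    push_cast
    omega
  · have := h.le_succ j (j + 1 - p) h1 h2 (by omega) (by omega)
    rw [show j + 1 + 1 - (p + 1) = j + 1 - p by omega]
    push_cast
    omega

theorem weightEll_reflect (w : ℕ → ℝ → ℂ) (L : ℕ → ℕ → ℤ) :
    weightEll N k (reflectWeight M w) (reflectEll M L) = weightEll N k w L := by
  have h1 : ∀ n, vand n (reflectEll M L n) = vand n (L n) := fun n => vand_reflect n _ _
  rw [weightEll, weightEll, h1, h1, weightProd, weightProd]
  congr 1
  refine prod_congr rfl fun j _ => ?_
  rw [← prod_Icc_reflect j fun p => w j (L j p)]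
  refine prod_congr rfl fun p _ => ?_
  rw [reflectWeight, reflectEll]
  congr 1
  push_cast
  ring

theorem ell_reflect {A : Arr N k M} (hA : A ∈ stateSpace N k M) {j p : ℕ} (hk : k ≤ j)
    (hN : j ≤ N) (hp : 1 ≤ p) (hpj : p ≤ j) :
    ell (reflect A) j p = (M : ℤ) - j - 1 - ell A j (j + 1 - p) :=
  ell_ofEll (mem_stateSpace.1 hA).reflectEll hk hN hp hpj

theorem reflect_mem {A : Arr N k M} (hA : A ∈ stateSpace N k M) :
    reflect A ∈ stateSpace N k M :=
  ofEll_mem (mem_stateSpace.1 hA).reflectEll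

theorem reflect_reflect {A : Arr N k M} (hA : A ∈ stateSpace N k M) : reflect (reflect A) = A := by
  refine ell_ext fun j p h1 h2 h3 h4 => ?_
  rw [ell_reflect (reflect_mem hA) h1 h2 h3 h4, ell_reflect hA h1 h2 (by omega) (by omega),
    show j + 1 - (j + 1 - p) = p by omega]
  ring

theorem weight_reflect (hkN : k ≤ N) (w : ℕ → ℝ → ℂ) {A : Arr N k M}
    (hA : A ∈ stateSpace N k M) :
    weight 1 (reflectWeight M w) (reflect A) = weight 1 w A := by
  rw [weight_one (reflect_mem hA) hkN, weight_one hA hkN]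
  change _ = weightEll N k w (ell A)
  rw [← weightEll_reflect (M := M)]
  have h : ∀ j p, k ≤ j → j ≤ N → 1 ≤ p → p ≤ j →
      ell (reflect A) j p = reflectEll M (ell A) j p := fun j p h1 h2 h3 h4 =>
    ell_reflect hA h1 h2 h3 h4
  rw [weightEll, vand_congr fun p hp => h N p hkN le_rfl (mem_Icc.1 hp).1 (mem_Icc.1 hp).2,
    vand_congr fun p hp => h k p le_rfl hkN (mem_Icc.1 hp).1 (mem_Icc.1 hp).2]
  congr 1
  refine prod_congr rfl fun j hj => prod_congr rfl fun p hp => ?_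
  rw [mem_Icc] at hj hp
  rw [h j p hj.1 hj.2 hp.1 hp.2]

theorem sum_reflect {f g : Arr N k M → ℂ} (h : ∀ A ∈ stateSpace N k M, f A = g (reflect A)) :
    ∑ A ∈ stateSpace N k M, f A = ∑ A ∈ stateSpace N k M, g A :=
  sum_nbij' reflect reflect (fun _ => reflect_mem) (fun _ => reflect_mem)
    (fun _ => reflect_reflect) (fun _ => reflect_reflect) h

/-- Reflection is an involution of the state space carrying the weight for `w` to the weight for
`reflectWeight M w`, so the normalizations agree as well. -/
theorem expect_reflect (hkN : k ≤ N) (w : ℕ → ℝ → ℂ) {f g : Arr N k M → ℂ}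
    (h : ∀ A ∈ stateSpace N k M, f A = g (reflect A)) :
    expect 1 w f = expect 1 (reflectWeight M w) g := by
  have hZ : Z N k M 1 w = Z N k M 1 (reflectWeight M w) :=
    sum_reflect fun A hA => (weight_reflect hkN w hA).symm
  refine sum_reflect fun A hA => ?_
  rw [prob, prob, weight_reflect hkN w hA, hZ, h A hA]

theorem ell_reflect_complex {A : Arr N k M} (hA : A ∈ stateSpace N k M) {j p : ℕ} (hk : k ≤ j)
    (hN : j ≤ N) (hp : 1 ≤ p) (hpj : p ≤ j) :
    (ell (reflect A) j p : ℂ) = (M : ℂ) - j - 1 - ell A j (j + 1 - p) := by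
  rw [ell_reflect hA hk hN hp hpj]
  push_cast
  rfl

theorem Res₂_eq_Res₁ (hk : 1 ≤ k) (hkN : k ≤ N) (w : ℕ → ℝ → ℂ) (φ : ℕ → ℂ → ℂ) (z : ℂ) :
    Res₂ N k M w φ z =
      Res₁ N k M (reflectWeight M w) (fun j z => φ j ((M : ℂ) - N - z)) ((M : ℂ) - N - z) := by
  have eM : ∀ (A : Arr N k M) j p, loc 1 A j p = (M : ℝ) - 1 ↔ ell A j p = (M : ℤ) - 1 :=
    fun A j p => by rw [← loc_one_eq_iff]; push_cast; rfl
  have eN : ∀ (A : Arr N k M) j p n, loc 1 A j p = -((n : ℕ) : ℝ) ↔ ell A j p = -(n : ℤ) :=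
    fun A j p n => by rw [← loc_one_eq_iff]; push_cast; rfl
  have h1 : ∀ A ∈ stateSpace N k M, ∀ j, k ≤ j → j ≤ N →
      (ell A j 1 = (M : ℤ) - 1 ↔ ell (reflect A) j j = -(j : ℤ)) := fun A hA j h1 h2 => by
    rw [ell_reflect hA h1 h2 (by omega) le_rfl, show j + 1 - j = 1 by omega]
    omega
  have h2 : ∀ A ∈ stateSpace N k M, ∀ j, k ≤ j → j ≤ N →
      (ell A j j = -(j : ℤ) ↔ ell (reflect A) j 1 = (M : ℤ) - 1) := fun A hA j h1 h2 => by
    rw [ell_reflect hA h1 h2 le_rfl (by omega), show j + 1 - 1 = j by omega]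
    omega
  simp only [Res₂, Res₁, loc_one_complex, eM, eN]
  congr 1
  · congr 1
    · rw [expect_reflect hkN w (g := fun A : Arr N k M =>
        (∏ p ∈ Icc 1 (N - 1), ((ell A N p : ℂ) + N + 1) / ((ell A N p : ℂ) + N)) *
          (if ell A N N = -(N : ℤ) then 1 else 0)) fun A hA => ?_]
      · congr 1
        rw [show (M : ℂ) - N - -N = M by ring, show (M : ℂ) - N - z + N = -(z - M) by ring,
          neg_one_mul, neg_div_neg_eq]
      · simp only [h1 A hA N hkN le_rfl]
        congr 1
        refine prod_nbij' (fun p => N + 1 - p) (fun p => N + 1 - p) ?_ ?_ ?_ ?_ fun p hp => ?_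
        all_goals try
          · intro p hp
            simp only [mem_Icc] at hp ⊢
            omega
        rw [mem_Icc] at hp
        rw [ell_reflect_complex hA hkN le_rfl (by omega) (by omega),
          show N + 1 - (N + 1 - p) = p by omega]
        congr 1 <;> ring
    · rw [expect_reflect hkN w (g := fun A : Arr N k M =>
        (∏ p ∈ Icc 2 k, ((M : ℂ) - ell A k p) / ((M : ℂ) - ell A k p - 1)) *
          (if ell A k 1 = (M : ℤ) - 1 then 1 else 0)) fun A hA => ?_]
      · congr 1
        rw [show (M : ℂ) - N - M = -N by ring, show (M : ℂ) - N - z - M = -(z + N) by ring,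
          neg_one_mul, div_neg, neg_div]
      · simp only [h2 A hA k le_rfl hkN]
        congr 1
        refine prod_nbij' (fun p => k + 1 - p) (fun p => k + 1 - p) ?_ ?_ ?_ ?_ fun p hp => ?_
        all_goals try
          · intro p hp
            simp only [mem_Icc] at hp ⊢
            omega
        rw [mem_Icc] at hp
        rw [ell_reflect_complex hA le_rfl hkN (by omega) (by omega),
          show k + 1 - (k + 1 - p) = p by omega]
        congr 1 <;> ring
  · refine sum_congr rfl fun j hj => ?_
    rw [mem_Icc] at hj
    rw [expect_reflect hkN w (g := fun A : Arr N k M =>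
      if ell A j 1 = (M : ℤ) - 1 then 1 else 0) fun A hA => ?_]
    · congr 1
      rw [show (M : ℂ) - N - M = -N by ring, show (M : ℂ) - N - z - M = -(z + N) by ring,
        neg_one_mul, div_neg, neg_div]
    · simp only [h2 A hA j (by omega) hj.2]

/-- Level `j` is reflected by `ℓ ↦ M - j - 1 - ℓ`. With `z' = M - N - z` this gives `z' - ℓ' - 1 =
-(z - ℓ + N - j)`, which is the origin of the level-dependent shifts in `R₂`; the endpoints `-N` and
`M` are interchanged. -/
theorem R₂_eq_R₁ (hk : 1 ≤ k) (hkN : k ≤ N) (w : ℕ → ℝ → ℂ) (φ : ℕ → ℂ → ℂ) (z : ℂ) :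
    R₂ N k M w φ z =
      R₁ N k M (reflectWeight M w) (fun j z => φ j ((M : ℂ) - N - z)) ((M : ℂ) - N - z) := by
  simp only [R₁, R₂, ← Res₂_eq_Res₁ hk hkN, sub_sub_cancel, loc_one_complex]
  refine congrArg₂ _ (congrArg₂ _ (congrArg₂ _ (congrArg _ ?_) (congrArg _ ?_)) ?_) rfl
  · refine expect_reflect hkN w fun A hA => ?_
    rw [← prod_Icc_reflect]
    refine prod_congr rfl fun p hp => ?_
    rw [mem_Icc] at hp
    rw [ell_reflect_complex hA hkN le_rfl hp.1 hp.2, ← neg_div_neg_eq]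
    congr 1 <;> ring
  · refine expect_reflect hkN w fun A hA => ?_
    rw [← prod_Icc_reflect]
    refine prod_congr rfl fun p hp => ?_
    rw [mem_Icc] at hp
    rw [ell_reflect_complex hA le_rfl hkN hp.1 hp.2, ← neg_div_neg_eq]
    congr 1 <;> ring
  · refine sum_congr rfl fun j hj => ?_
    rw [mem_Icc] at hj
    refine congrArg _ (expect_reflect hkN w fun A hA => ?_)
    rw [← sum_Icc_reflect j, ← sum_Icc_reflect (j - 1), ← sum_neg_distrib,
      sub_eq_add_neg (∑ p ∈ Icc 1 j, _), ← sum_neg_distrib]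
    refine congrArg₂ _ ?_ ?_
    · refine sum_congr rfl fun p hp => ?_
      rw [mem_Icc] at hp
      rw [ell_reflect_complex hA (by omega) hj.2 hp.1 hp.2, ← div_neg]
      congr 1
      ring
    · refine sum_congr rfl fun p hp => ?_
      rw [mem_Icc] at hp
      rw [ell_reflect_complex hA (by omega) (by omega) hp.1 hp.2, ← div_neg,
        Nat.cast_sub (show 1 ≤ j by omega)]
      congr 1
      push_cast
      ring

theorem exists_analytic_eq_R₂ (hk : 1 ≤ k) (hkN : k ≤ N) {w : ℕ → ℝ → ℂ}
    (hw : ∀ j ∈ Icc k N, ∀ x ∈ Set.Icc (-(j : ℝ)) ((M : ℝ) - 1), w j x ≠ 0)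
    {𝓜 : Set ℂ} (h𝓜 : IsOpen 𝓜) (hsub : ∀ x ∈ Set.Icc (-(N : ℝ)) (M : ℝ), (x : ℂ) ∈ 𝓜)
    {φ : ℕ → ℂ → ℂ} (hφ : ∀ j ∈ Icc k (N + 1), AnalyticOnNhd ℂ (φ j) 𝓜)
    (hratio : ∀ j ∈ Icc k N, ∀ x ∈ Set.Icc (1 - (N : ℝ)) ((M : ℝ) - N + j - 1),
      φ j (x : ℂ) / φ (j + 1) (x : ℂ) = w j (x + N - j - 1) / w j (x + N - j)) :
    ∃ F : ℂ → ℂ, AnalyticOnNhd ℂ F 𝓜 ∧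
      ∀ z ∈ 𝓜, (∀ n ∈ Set.Icc (-(N : ℤ)) (M : ℤ), z ≠ (n : ℂ)) → F z = R₂ N k M w φ z := by
  have hρ : Differentiable ℂ fun z : ℂ => (M : ℂ) - N - z := by fun_prop
  obtain ⟨F, hF, hFR⟩ := exists_analytic_eq_R₁ (M := M) hk hkN (w := reflectWeight M w)
    (𝓜 := (fun z : ℂ => (M : ℂ) - N - z) ⁻¹' 𝓜) (φ := fun j z => φ j ((M : ℂ) - N - z))
    (fun j hj x hx => hw j hj _ ⟨by linarith [hx.2], by linarith [hx.1]⟩)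
    (h𝓜.preimage hρ.continuous)
    (fun x hx => by
      have := hsub ((M : ℝ) - N - x) ⟨by linarith [hx.2], by linarith [hx.1]⟩
      push_cast at this
      exact this)
    (fun j hj z hz => (hφ j hj _ hz).comp_of_eq (hρ.analyticAt z) rfl)
    (fun j hj x hx => by
      have h := hratio j hj ((M : ℝ) - N - x) ⟨by linarith [hx.2], by linarith [hx.1]⟩
      -- Reflection swaps the arguments of `w_j` in the numerator and the denominator, so the ratio
      -- must be inverted to become the hypothesis of the first equation.
      have h' := congrArg (·⁻¹) h
      simp only [inv_div] at h'
      push_cast at h'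
      rw [h', reflectWeight, reflectWeight]
      congr 2 <;> ring)
  refine ⟨fun z => F ((M : ℂ) - N - z), fun z hz => ?_, fun z hz hn => ?_⟩
  · exact (hF _ (by simpa using hz)).comp_of_eq (hρ.analyticAt z) rfl
  · rw [R₂_eq_R₁ hk hkN]
    refine hFR _ (by simpa using hz) fun n hn' h => ?_
    rw [Set.mem_Icc] at hn'
    refine hn ((M : ℤ) - N - n) ⟨by omega, by omega⟩ ?_
    push_cast
    rw [← h]
    ring

end

end

end BetaCorners

/-- Multi-level Nekrasov equations for `θ = 1`. The formulas for `R₁` and `R₂` make sense on `𝓜`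
away from the integers `-N, …, M`; that they are analytic in `𝓜` means that these integers are
removable singularities. -/
theorem theorem2p2 (N k M : ℕ) (hk : 1 ≤ k) (hkN : k ≤ N)
    (w : ℕ → ℝ → ℂ)
    (hw : ∀ j ∈ Finset.Icc k N, ∀ x ∈ Set.Icc (-(j : ℝ)) ((M : ℝ) - 1), w j x ≠ 0)
    (hZ : BetaCorners.Z N k M 1 w ≠ 0)
    (𝓜 : Set ℂ) (h𝓜 : IsOpen 𝓜)
    (hsub : ∀ x ∈ Set.Icc (-(N : ℝ)) (M : ℝ), (x : ℂ) ∈ 𝓜)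
    (φ₁ φ₂ : ℕ → ℂ → ℂ)
    (hφ₁ : ∀ j ∈ Finset.Icc k (N + 1), AnalyticOnNhd ℂ (φ₁ j) 𝓜)
    (hφ₂ : ∀ j ∈ Finset.Icc k (N + 1), AnalyticOnNhd ℂ (φ₂ j) 𝓜)
    (hratio₁ : ∀ j ∈ Finset.Icc k N, ∀ x ∈ Set.Icc (1 - (j : ℝ)) ((M : ℝ) - 1),
      φ₁ (j + 1) (x : ℂ) / φ₁ j (x : ℂ) = w j (x - 1) / w j x)
    (hratio₂ : ∀ j ∈ Finset.Icc k N, ∀ x ∈ Set.Icc (1 - (N : ℝ)) ((M : ℝ) - N + j - 1),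
      φ₂ j (x : ℂ) / φ₂ (j + 1) (x : ℂ) = w j (x + N - j - 1) / w j (x + N - j)) :
    (∃ F₁ : ℂ → ℂ, AnalyticOnNhd ℂ F₁ 𝓜 ∧
      ∀ z ∈ 𝓜, (∀ n ∈ Set.Icc (-(N : ℤ)) (M : ℤ), z ≠ (n : ℂ)) →
        F₁ z = BetaCorners.R₁ N k M w φ₁ z) ∧
    (∃ F₂ : ℂ → ℂ, AnalyticOnNhd ℂ F₂ 𝓜 ∧
      ∀ z ∈ 𝓜, (∀ n ∈ Set.Icc (-(N : ℤ)) (M : ℤ), z ≠ (n : ℂ)) →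
        F₂ z = BetaCorners.R₂ N k M w φ₂ z) := by
  exact ⟨BetaCorners.exists_analytic_eq_R₁ hk hkN hw h𝓜 hsub hφ₁ hratio₁,
    BetaCorners.exists_analytic_eq_R₂ hk hkN hw h𝓜 hsub hφ₂ hratio₂⟩
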